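/- Let $d\in\{2,3\}$, let $\mathcal D\subset\mathbb R^d$ be a bounded polyhedral open set and let $\mathcal T_h$ be a conformal mesh of $\mathcal D$ made of finitely many closed $d$-simplices $K_1,\dots,K_{N_K}$, with internal edges ($d=2$) or faces ($d=3$) $E_1,\dots,E_{N_E}$ and a unit normal $\boldsymbol n$ (of arbitrary orientation) on each $E_j$. Let $\mathrm{Re}\ge 0$, $\mathrm{Wi}>0$, $0\le\varepsilon<1$, $T>0$, $N_T\ge 1$ and $\Delta t=T/N_T$. Let $(\mathbb P_2)^d$ be the space of continuous vector fields on $\overline{\mathcal D}$ that vanish on $\partial\mathcal D$ and whose components are polynomials of degree at most $2$ on each $K_k$; let $\mathbb P_{1,disc}$ be the space of scalar fields that are polynomials of degree at most $1$ on each $K_k$ (with no continuity condition); and let $(\mathbb P_0)^{d(d+1)/2}$ be the space of symmetric $d\times d$ matrix fields that are constant on each $K_k$. Write $(\nabla\boldsymbol u)_{ij}=\partial_{x_j}\boldsymbol u_i$, $(\boldsymbol w\cdot\nabla\boldsymbol u)_i=\sum_j\boldsymbol w_j\partial_{x_j}\boldsymbol u_i$, $A:B=\operatorname{tr}(AB^T)$,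 and, at a point $\boldsymbol x$ of an internal edge, $\boldsymbol\phi^{\pm}(\boldsymbol x)=\lim_{\delta\to0^{\pm}}\boldsymbol\phi(\boldsymbol x+\delta\,\boldsymbol u_h^n(\boldsymbol x))$ and $[\![\boldsymbol\phi]\!]=\boldsymbol\phi^+-\boldsymbol\phi^-$ (these are only used where $\boldsymbol u_h^n\cdot\boldsymbol n\neq0$). Let $(\boldsymbol u_h^n,p_h^n,\boldsymbol\sigma_h^n)_{0\le n\le N_T}$ be elements of $(\mathbb P_2)^d\times\mathbb P_{1,disc}\times(\mathbb P_0)^{d(d+1)/2}$ such that, for all $0\le n\le N_T-1$ and all test functions $(\boldsymbol v,q,\boldsymbol\phi)\in(\mathbb P_2)^d\times\mathbb P_{1,disc}\times(\mathbb P_0)^{d(d+1)/2}$, $$ \begin{aligned} 0=\sum_{k=1}^{N_K}\int_{K_k}\Big[&\mathrm{Re}\Big(\frac{\boldsymbol u_h^{n+1}-\boldsymbol u_h^n}{\Delta t}+\boldsymbol u_h^n\cdot\nabla\boldsymbol u_h^{n+1}\Big)\cdot\boldsymbol v-p_h^{n+1}\operatorname{div}\boldsymbol v+q\operatorname{div}\boldsymbol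 u_h^{n+1}\\ &+(1-\varepsilon)\nabla\boldsymbol u_h^{n+1}:\nabla\boldsymbol v+\frac{\varepsilon}{\mathrm{Wi}}\boldsymbol\sigma_h^{n+1}:\nabla\boldsymbol v+\frac{\boldsymbol\sigma_h^{n+1}-\boldsymbol\sigma_h^n}{\Delta t}:\boldsymbol\phi\\ &-\big((\nabla\boldsymbol u_h^{n+1})\boldsymbol\sigma_h^{n+1}+\boldsymbol\sigma_h^{n+1}(\nabla\boldsymbol u_h^{n+1})^T\big):\boldsymbol\phi+\frac1{\mathrm{Wi}}(\boldsymbol\sigma_h^{n+1}-\boldsymbol I):\boldsymbol\phi\Big]\\ &+\sum_{j=1}^{N_E}\int_{E_j}|\boldsymbol u_h^n\cdot\boldsymbol n|\,[\![\boldsymbol\sigma_h^{n+1}]\!]:\boldsymbol\phi^+ . \end{aligned} $$ Assume that the initial velocity is divergence free, in the sense that $\int_{\mathcal D}q\operatorname{div}\boldsymbol u_h^0=0$ for all $q\in\mathbb P_{1,disc}$, and that $\boldsymbol\sigma_h^n$ is positive definite for all $0\le n\le N_T$. Then the discrete free energy $$F_h^n=\frac{\mathrm{Re}}2\int_{\mathcal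 D}|\boldsymbol u_h^n|^2+\frac{\varepsilon}{2\mathrm{Wi}}\int_{\mathcal D}\operatorname{tr}(\boldsymbol\sigma_h^n-\ln\boldsymbol\sigma_h^n-\boldsymbol I)$$ satisfies, for all $0\le n\le N_T-1$, $$F_h^{n+1}-F_h^n+\int_{\mathcal D}\frac{\mathrm{Re}}2|\boldsymbol u_h^{n+1}-\boldsymbol u_h^n|^2+\Delta t\int_{\mathcal D}\Big[(1-\varepsilon)|\nabla\boldsymbol u_h^{n+1}|^2+\frac{\varepsilon}{2\mathrm{Wi}^2}\operatorname{tr}\big(\boldsymbol\sigma_h^{n+1}+(\boldsymbol\sigma_h^{n+1})^{-1}-2\boldsymbol I\big)\Big]\le0 .$$ In particular, the sequence $(F_h^n)_{0\le n\le N_T}$ is non-increasing. -/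

import Mathlib

open MeasureTheory Topology

namespace OldroydDG

noncomputable section

/-- The Euclidean space `ℝ^d`. -/
abbrev Space (d : ℕ) : Type := EuclideanSpace ℝ (Fin d)

/-- Real `d × d` matrices (rank-two tensors). -/
abbrev Tensor (d : ℕ) : Type := Matrix (Fin d) (Fin d) ℝ

/-- Double contraction `A : B = tr (A Bᵀ) = ∑ i j, A i j * B i j`. -/
def contract {d : ℕ} (A B : Tensor d) : ℝ := (A * B.transpose).trace

/-- Velocity gradient, `(∇u) i j = ∂u_i / ∂x_j`. -/
def grad {d : ℕ} (u : Space d → Space d) (x : Space d) : Tensor d :=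
  Matrix.of fun i j => (fderiv ℝ u x (EuclideanSpace.single j 1)) i

/-- Divergence of a vector field. -/
def divergence {d : ℕ} (u : Space d → Space d) (x : Space d) : ℝ := (grad u x).trace

/-- The logarithm of a symmetric positive definite matrix, through its spectral decomposition. -/
def matLog {d : ℕ} (A : Tensor d) : Tensor d := cfc Real.log A

/-- A conformal mesh of the open set `D ⊆ ℝ^d`: a finite simplicial complex (two simplices meet
in a common face or not at all) in which every simplex is a face of a `d`-simplex, whose closed
`d`-simplices cover exactly the closure of `D`, and whose open `d`-simplices lie in `D`, so that
the boundary of `D` is made of mesh faces. In particular `D` is bounded and polyhedral. -/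
structure ConformalMesh (d : ℕ) (D : Set (Space d)) where
  complex : Geometry.SimplicialComplex ℝ (Space d)
  finite : complex.faces.Finite
  pure : ∀ s ∈ complex.faces, ∃ t ∈ complex.faces, s ⊆ t ∧ t.card = d + 1
  space_eq : complex.space = closure D
  interior_subset : ∀ s ∈ complex.faces, s.card = d + 1 →
    interior (convexHull ℝ (s : Set (Space d))) ⊆ D

variable {d : ℕ} {D : Set (Space d)}

/-- The elements `K_k`, each given by its set of `d + 1` vertices. -/
def ConformalMesh.elements (M : ConformalMesh d D) : Finset (Finset (Space d)) :=
  M.finite.toFinset.filter fun s => s.card = d + 1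

open Classical in
/-- The internal edges (`d = 2`) or faces (`d = 3`) `E_j`: the `(d - 1)`-simplices shared by two
distinct elements, each given by its set of `d` vertices. -/
def ConformalMesh.internalFaces (M : ConformalMesh d D) : Finset (Finset (Space d)) :=
  M.finite.toFinset.filter fun e => e.card = d ∧
    ∃ s ∈ M.elements, ∃ t ∈ M.elements, s ≠ t ∧ e ⊆ s ∧ e ⊆ t

/-- The closed simplex with given vertices. -/
def cell (s : Finset (Space d)) : Set (Space d) := convexHull ℝ (s : Set (Space d))

open Classical in
/-- A unit vector orthogonal to a face, with an arbitrary orientation. -/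
def faceNormal (e : Finset (Space d)) : Space d :=
  if h : ∃ n : Space d, ‖n‖ = 1 ∧ n ∈ (vectorSpan ℝ (e : Set (Space d)))ᗮ then h.choose else 0

/-- The velocity space `(ℙ₂)^d` with homogeneous Dirichlet condition: vector fields that are
continuous on the closure of `D`, vanish on the boundary of `D`, and have on every element
components that are polynomials of degree at most `2`. -/
def IsVelocity (M : ConformalMesh d D) (u : Space d → Space d) : Prop :=
  ContinuousOn u (closure D) ∧
  (∀ x ∈ frontier D, u x = 0) ∧
  ∀ s ∈ M.elements, ∀ i : Fin d, ∃ P : MvPolynomial (Fin d) ℝ, P.totalDegree ≤ 2 ∧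
    ∀ x ∈ cell s, u x i = MvPolynomial.eval (fun j => x j) P

/-- The pressure space `ℙ_{1,disc}`: on every (open) element a polynomial of degree at most `1`,
with no condition across faces. -/
def IsPressure (M : ConformalMesh d D) (p : Space d → ℝ) : Prop :=
  ∀ s ∈ M.elements, ∃ P : MvPolynomial (Fin d) ℝ, P.totalDegree ≤ 1 ∧
    ∀ x ∈ interior (cell s), p x = MvPolynomial.eval (fun j => x j) P

/-- The stress space `(ℙ₀)^{d(d+1)/2}`: symmetric-matrix fields, constant on every (open)
element. -/
def IsStress (M : ConformalMesh d D) (σ : Space d → Tensor d) : Prop :=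
  ∀ s ∈ M.elements, ∃ A : Tensor d, A.IsSymm ∧ ∀ x ∈ interior (cell s), σ x = A

/-- The stress field is positive definite on every (open) element. -/
def IsPosDefStress (M : ConformalMesh d D) (σ : Space d → Tensor d) : Prop :=
  ∀ s ∈ M.elements, ∀ x ∈ interior (cell s), (σ x).PosDef

/-- `∫_D q div u = 0` for all `q ∈ ℙ_{1,disc}`. -/
def IsDiscretelyDivFree (M : ConformalMesh d D) (u : Space d → Space d) : Prop :=
  ∀ q : Space d → ℝ, IsPressure M q → (∫ x in D, q x * divergence u x) = 0

/-- Downstream value `φ⁺(x) = lim_{δ → 0⁺} φ (x + δ u(x))`. -/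
def downstream (u : Space d → Space d) (φ : Space d → Tensor d) (x : Space d) : Tensor d :=
  Filter.limUnder (𝓝[>] (0 : ℝ)) fun δ => φ (x + δ • u x)

/-- Upstream value `φ⁻(x) = lim_{δ → 0⁻} φ (x + δ u(x))`. -/
def upstream (u : Space d → Space d) (φ : Space d → Tensor d) (x : Space d) : Tensor d :=
  Filter.limUnder (𝓝[<] (0 : ℝ)) fun δ => φ (x + δ • u x)

/-- Jump `⟦φ⟧ = φ⁺ - φ⁻`. -/
def jump (u : Space d → Space d) (φ : Space d → Tensor d) (x : Space d) : Tensor d :=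
  downstream u φ x - upstream u φ x

/-- The right-hand side of the discontinuous Galerkin variational formulation: `u₀, σ₀` are the
fields at time `n`, `u₁, p₁, σ₁` those at time `n + 1`, and `v, q, φ` the test functions. Faces
carry the `(d - 1)`-dimensional surface measure. -/
def dgForm (M : ConformalMesh d D) (Re Wi ε Δt : ℝ)
    (u₀ : Space d → Space d) (σ₀ : Space d → Tensor d)
    (u₁ : Space d → Space d) (p₁ : Space d → ℝ) (σ₁ : Space d → Tensor d)
    (v : Space d → Space d) (q : Space d → ℝ) (φ : Space d → Tensor d) : ℝ :=
  (∑ s ∈ M.elements, ∫ x in cell s,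
    (Re * inner ℝ (Δt⁻¹ • (u₁ x - u₀ x) + fderiv ℝ u₁ x (u₀ x)) (v x)
      - p₁ x * divergence v x + q x * divergence u₁ x
      + (1 - ε) * contract (grad u₁ x) (grad v x)
      + ε / Wi * contract (σ₁ x) (grad v x)
      + contract (Δt⁻¹ • (σ₁ x - σ₀ x)) (φ x)
      - contract (grad u₁ x * σ₁ x + σ₁ x * (grad u₁ x).transpose) (φ x)
      + 1 / Wi * contract (σ₁ x - 1) (φ x)))
  + ∑ e ∈ M.internalFaces,
      ∫ x in cell e, |inner ℝ (u₀ x) (faceNormal e)|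
        * contract (jump u₀ σ₁ x) (downstream u₀ φ x)
        ∂(Measure.euclideanHausdorffMeasure (d - 1))

/-- `(u n, p n, σ n)`, `0 ≤ n ≤ N`, are finite element functions that solve the discontinuous
Galerkin scheme at every time step. -/
structure IsDGSolution (M : ConformalMesh d D) (Re Wi ε Δt : ℝ) (N : ℕ)
    (u : ℕ → Space d → Space d) (p : ℕ → Space d → ℝ) (σ : ℕ → Space d → Tensor d) : Prop where
  velocity : ∀ n ≤ N, IsVelocity M (u n)
  pressure : ∀ n ≤ N, IsPressure M (p n)
  stress : ∀ n ≤ N, IsStress M (σ n)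
  step : ∀ n < N, ∀ (v : Space d → Space d) (q : Space d → ℝ) (φ : Space d → Tensor d),
    IsVelocity M v → IsPressure M q → IsStress M φ →
      0 = dgForm M Re Wi ε Δt (u n) (σ n) (u (n + 1)) (p (n + 1)) (σ (n + 1)) v q φ

/-- The free energy `F(u, σ) = Re/2 ∫_D |u|² + ε/(2 Wi) ∫_D tr (σ - ln σ - I)`. -/
def freeEnergy (D : Set (Space d)) (Re Wi ε : ℝ) (u : Space d → Space d)
    (σ : Space d → Tensor d) : ℝ :=
  Re / 2 * (∫ x in D, ‖u x‖ ^ 2)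
    + ε / (2 * Wi) * ∫ x in D, (σ x - matLog (σ x) - 1).trace

end

end OldroydDG

/-! The step is tested with `v = u₁`, `q = p₁` and `φ = κ (1 - σ₁⁻¹)`, `κ = ε / (2 Wi)`, which is
admissible because `σ₁` is constant on each element. The pressure terms cancel. The upper-convected
terms give `2 κ σ₁ : ∇u₁ - 2 κ div u₁`; the first part cancels the elastic stress in the momentum
equation and the second vanishes. The relaxation term becomes the entropy dissipation.

The matrix `1 - A⁻¹` is the gradient of the convex entropy `S(A) = tr (A - ln A - 1) = tr A - log
det A - d`. Convexity, in the form `S(A) - S(B) ≤ (A - B) : (1 - A⁻¹)` (`entropy_sub_le_contract`),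
reduces by a congruence to `log λ ≤ λ - 1`. It is used twice: in time, where it bounds the stress
increment below by the entropy increment, and across faces, where the upwind jump term dominates `κ
|u₀ · n| (S⁺ - S⁻)` (`entropy_flux_le`). Regrouped by elements, the latter sums to `κ S` times the
flux of `u₀` through each element boundary, hence to zero because `div u₀ = 0`. So the face terms
are nonnegative and the volume terms nonpositive.

The velocities are divergence free pointwise, not only weakly: the divergence of a `ℙ₂` field lies
in `ℙ_{1,disc}`, so `q = div u` is admissible and gives `∫ (div u)² = 0`. This also makes the
convection term equal to half the divergence of `|u₁|² u₀`, of integral zero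
(`integral_convection_eq_zero`).

The geometric input is Green's formula on the mesh (`sum_mul_integral_divergence`). It rests on the
divergence theorem for one simplex, proved by viewing the simplex as a cone over each of its facets,
and on two facts about conformal meshes: an internal facet has exactly two adjacent elements, with
opposite normals, and the relative interior of any other facet lies on the boundary of the domain.
-/

namespace OldroydDG

/-! ### Positive definite matrices -/

section Matrices

variable {n : Type*} [Fintype n] [DecidableEq n]

lemma trace_cfc_log {A : Matrix n n ℝ} (hA : A.PosDef) :
    (cfc Real.log A).trace = Real.log A.det := by
  rw [hA.1.cfc_eq, Matrix.IsHermitian.cfc, Unitary.conjStarAlgAut_apply, Matrix.trace_mul_cycle,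
    Unitary.coe_star_mul_self, one_mul, Matrix.trace_diagonal, hA.1.det_eq_prod_eigenvalues]
  simp only [RCLike.ofReal_real_eq_id, id, Function.comp_apply]
  rw [Real.log_prod]
  exact fun i _ => (hA.eigenvalues_pos i).ne'

lemma log_det_le_trace_sub_card {A : Matrix n n ℝ} (hA : A.PosDef) :
    Real.log A.det ≤ A.trace - Fintype.card n := by
  rw [hA.1.det_eq_prod_eigenvalues, hA.1.trace_eq_sum_eigenvalues]
  simp only [RCLike.ofReal_real_eq_id, id]
  rw [Real.log_prod fun i _ => (hA.eigenvalues_pos i).ne']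
  calc ∑ i, Real.log (hA.1.eigenvalues i) ≤ ∑ i, (hA.1.eigenvalues i - 1) :=
        Finset.sum_le_sum fun i _ => Real.log_le_sub_one_of_pos (hA.eigenvalues_pos i)
    _ = _ := by simp

open scoped MatrixOrder in
-- `A * B⁻¹` need not be symmetric. Writing `B⁻¹ = Xᵀ X`, the congruent matrix `X A Xᵀ` is positive
-- definite with the same trace and determinant, so the eigenvalue bound applies to it.
lemma log_det_sub_le_trace_mul_inv {A B : Matrix n n ℝ} (hA : A.PosDef) (hB : B.PosDef) :
    Real.log A.det - Real.log B.det ≤ (A * B⁻¹).trace - Fintype.card n := by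
  obtain ⟨X, hX⟩ := CStarAlgebra.nonneg_iff_eq_star_mul_self.mp hB.inv.posSemidef.nonneg
  rw [Matrix.star_eq_conjTranspose] at hX
  have hdet : B.det⁻¹ = X.det * X.det := by
    have := congrArg Matrix.det hX
    rwa [Matrix.det_nonsing_inv, Ring.inverse_eq_inv', Matrix.det_mul, Matrix.det_conjTranspose,
      star_trivial] at this
  have hX0 : X.det ≠ 0 := by
    intro h
    rw [h, mul_zero, inv_eq_zero] at hdet
    exact hB.det_pos.ne' hdet
  have hC : (X * A * X.conjTranspose).PosDef := by
    have hu : IsUnit X := (Matrix.isUnit_iff_isUnit_det _).2 (isUnit_iff_ne_zero.2 hX0)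
    exact (Matrix.IsUnit.posDef_star_right_conjugate_iff hu).2 hA
  have h1 := log_det_le_trace_sub_card hC
  have h2 : (X * A * X.conjTranspose).trace = (A * B⁻¹).trace := by
    rw [Matrix.trace_mul_comm, ← mul_assoc, ← hX, Matrix.trace_mul_comm]
  have h3 : (X * A * X.conjTranspose).det = A.det * B.det⁻¹ := by
    rw [Matrix.det_mul, Matrix.det_mul, Matrix.det_conjTranspose, star_trivial, hdet]; ring
  rw [h2, h3, Real.log_mul hA.det_pos.ne' (inv_ne_zero hB.det_pos.ne'), Real.log_inv] at h1
  linarith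

/-- The bound on `log det` is added for `A` and for `A⁻¹`; the logarithms cancel. This sign is what
makes the free energy monotone. -/
lemma trace_add_inv_sub_two_nonneg {A : Matrix n n ℝ} (hA : A.PosDef) :
    0 ≤ (A + A⁻¹ - (2 : ℝ) • 1).trace := by
  have h1 := log_det_le_trace_sub_card hA
  have h2 := log_det_le_trace_sub_card hA.inv
  rw [Matrix.det_nonsing_inv, Ring.inverse_eq_inv', Real.log_inv] at h2
  simp only [Matrix.trace_sub, Matrix.trace_add, Matrix.trace_smul, Matrix.trace_one, smul_eq_mul]
  linarith

end Matrices

/-! ### The entropy density and its gradient -/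

variable {d : ℕ}

lemma contract_one_sub_inv {A B : Tensor d} (hA : A.PosDef) :
    contract B (1 - A⁻¹) = B.trace - (B * A⁻¹).trace := by
  have : (A⁻¹).transpose = A⁻¹ := by
    have := hA.inv.1
    rwa [Matrix.IsHermitian, Matrix.conjTranspose_eq_transpose_of_trivial] at this
  rw [contract, Matrix.transpose_sub, Matrix.transpose_one, this, mul_sub, mul_one,
    Matrix.trace_sub]

/-- The entropy density is convex: its differential is `1 - A⁻¹`. -/
lemma entropy_sub_le_contract {A B : Tensor d} (hA : A.PosDef) (hB : B.PosDef) :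
    (A - matLog A - 1).trace - (B - matLog B - 1).trace ≤ contract (A - B) (1 - A⁻¹) := by
  have h := log_det_sub_le_trace_mul_inv hB hA
  rw [contract_one_sub_inv hA, sub_mul,
    Matrix.mul_nonsing_inv _ (isUnit_iff_ne_zero.2 hA.det_pos.ne')]
  simp only [matLog, Matrix.trace_sub, trace_cfc_log hA, trace_cfc_log hB, Matrix.trace_one]
  linarith

lemma contract_sub_one_one_sub_inv {A : Tensor d} (hA : A.PosDef) :
    contract (A - 1) (1 - A⁻¹) = (A + A⁻¹ - (2 : ℝ) • 1).trace := by
  rw [contract_one_sub_inv hA, sub_mul,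
    Matrix.mul_nonsing_inv _ (isUnit_iff_ne_zero.2 hA.det_pos.ne'),
    one_mul]
  simp only [Matrix.trace_sub, Matrix.trace_add, Matrix.trace_smul, Matrix.trace_one, smul_eq_mul]
  ring

/-- The upper-convected terms contribute `2 A : G - 2 tr G`. -/
lemma contract_upper_convected {A G : Tensor d} (hA : A.PosDef) :
    contract (G * A + A * G.transpose) (1 - A⁻¹) = 2 * contract A G - 2 * G.trace := by
  have hu := isUnit_iff_ne_zero.2 hA.det_pos.ne'
  have hAt : A.transpose = A := by
    have := hA.1
    rwa [Matrix.IsHermitian, Matrix.conjTranspose_eq_transpose_of_trivial] at this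
  have h1 : (G * A).trace = contract A G := by
    rw [contract, ← Matrix.trace_transpose (G * A), Matrix.transpose_mul, hAt]
  have h2 : (A * G.transpose * A⁻¹).trace = G.trace := by
    rw [Matrix.trace_mul_cycle, Matrix.nonsing_inv_mul _ hu, one_mul, Matrix.trace_transpose]
  rw [contract_one_sub_inv hA, add_mul, Matrix.trace_add, Matrix.trace_add, h2, mul_assoc,
    Matrix.mul_nonsing_inv _ hu, mul_one, h1, ← contract]
  ring

/-! ### Integration over cones -/

section Cone

set_option linter.unusedSectionVars false

open scoped Pointwise
open Module

variable {E : Type*} [NormedAddCommGroup E] [InnerProductSpace ℝ E] [FiniteDimensional ℝ E]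
  [MeasurableSpace E] [BorelSpace E]

/-- Cartesian coordinates with origin `z`, adapted to the hyperplanes orthogonal to the unit
vector `n`. -/
noncomputable def normalCoordinates (z : E) {n : E} (hn : ‖n‖ = 1) : ℝ × (ℝ ∙ n)ᗮ ≃ᵐ E :=
  (MeasurableEquiv.prodCongr
    (LinearIsometryEquiv.toSpanUnitSingleton n hn).toHomeomorph.toMeasurableEquiv
    (MeasurableEquiv.refl _)).trans ((ℝ ∙ n).measurableEquivProd z).symm

lemma normalCoordinates_apply (z : E) {n : E} (hn : ‖n‖ = 1) (q : ℝ × (ℝ ∙ n)ᗮ) :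
    normalCoordinates z hn q = z + (q.1 • n + q.2) := by
  rw [normalCoordinates, MeasurableEquiv.trans_apply, Submodule.measurableEquivProd_symm_apply,
    vadd_eq_add, add_comm]
  rfl

lemma measurePreserving_normalCoordinates (z : E) {n : E} (hn : ‖n‖ = 1) :
    MeasurePreserving (normalCoordinates z hn) (volume.prod volume) volume := by
  have h1 := ((ℝ ∙ n).measurePreserving_measurableEquivProd z).symm
  rw [InnerProductSpace.euclideanHausdorffMeasure_eq_volume] at h1
  refine MeasurePreserving.trans (MeasurePreserving.prod ?_ (MeasurePreserving.id _)) h1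
  exact (LinearIsometryEquiv.toSpanUnitSingleton n hn).measurePreserving

lemma finrank_orthogonal_unit {m : ℕ} (hm : finrank ℝ E = m + 1) {n : E} (hn : ‖n‖ = 1) :
    finrank ℝ (ℝ ∙ n)ᗮ = m := by
  have h1 := (ℝ ∙ n).finrank_add_finrank_orthogonal
  rw [finrank_span_singleton (by rintro rfl; simp at hn), hm] at h1
  omega

lemma isometry_hyperplane (w n : E) : Isometry fun y : (ℝ ∙ n)ᗮ => w + (y : E) :=
  (IsometryEquiv.addLeft w).isometry.comp isometry_subtype_coe

lemma mem_range_hyperplane (w n x : E) :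
    x ∈ Set.range (fun y : (ℝ ∙ n)ᗮ => w + (y : E)) ↔ inner ℝ n (x - w) = 0 := by
  rw [← Submodule.mem_orthogonal_singleton_iff_inner_right]
  constructor
  · rintro ⟨y, rfl⟩
    simp
  · intro h
    exact ⟨⟨_, h⟩, by simp⟩

/-- Isometries preserve Hausdorff measure, and on the `m`-dimensional direction space it is Lebesgue
measure. Surface integrals over flat pieces thus become Lebesgue integrals. -/
lemma map_volume_hyperplane {m : ℕ} (hm : finrank ℝ E = m + 1) {n : E} (hn : ‖n‖ = 1) (w : E) :
    (volume : Measure (ℝ ∙ n)ᗮ).map (fun y : (ℝ ∙ n)ᗮ => w + (y : E)) =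
      (Measure.euclideanHausdorffMeasure m).restrict {x : E | inner ℝ n (x - w) = 0} := by
  have h1 := (isometry_hyperplane w n).map_euclideanHausdorffMeasure (d := m)
  have h2 := InnerProductSpace.euclideanHausdorffMeasure_eq_volume (V := (ℝ ∙ n)ᗮ)
  rw [finrank_orthogonal_unit hm hn] at h2
  rw [h2] at h1
  rw [h1]
  congr 1
  ext x
  exact mem_range_hyperplane w n x

lemma measurableEmbedding_hyperplane (w n : E) :
    MeasurableEmbedding fun y : (ℝ ∙ n)ᗮ => w + (y : E) :=
  (isometry_hyperplane w n).isClosedEmbedding.measurableEmbedding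

/-- Surface integrals over a piece of a hyperplane. -/
lemma setIntegral_hyperplane {m : ℕ} (hm : finrank ℝ E = m + 1) {n : E} (hn : ‖n‖ = 1) (w : E)
    {e : Set E} (he : MeasurableSet e) (hew : ∀ x ∈ e, inner ℝ n (x - w) = 0) (f : E → ℝ) :
    ∫ x in e, f x ∂(Measure.euclideanHausdorffMeasure m) =
      ∫ y in (fun y : (ℝ ∙ n)ᗮ => w + (y : E)) ⁻¹' e, f (w + y) := by
  rw [← (measurableEmbedding_hyperplane w n).setIntegral_map, map_volume_hyperplane hm hn,
    Measure.restrict_restrict he, Set.inter_eq_left.2]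
  exact hew

lemma measure_hyperplane {m : ℕ} (hm : finrank ℝ E = m + 1) {n : E} (hn : ‖n‖ = 1) (w : E)
    {e : Set E} (he : MeasurableSet e) (hew : ∀ x ∈ e, inner ℝ n (x - w) = 0) :
    Measure.euclideanHausdorffMeasure m e =
      volume ((fun y : (ℝ ∙ n)ᗮ => w + (y : E)) ⁻¹' e) := by
  rw [← (measurableEmbedding_hyperplane w n).map_apply, map_volume_hyperplane hm hn,
    Measure.restrict_apply he, Set.inter_eq_left.2]
  exact hew

/-- The cone with apex `z` and base `e`. -/
def cone (z : E) (e : Set E) : Set E :=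
  Set.image (fun q : ℝ × E => z + q.1 • (q.2 - z)) (Set.Icc 0 1 ×ˢ e)

lemma isCompact_cone (z : E) {e : Set E} (he : IsCompact e) : IsCompact (cone z e) :=
  (isCompact_Icc.prod he).image (by fun_prop)

/-- The divergence theorem for the radial field `x ↦ f x • (x - z)` on a cone with apex `z`. -/
theorem integral_cone {m : ℕ} (hm : finrank ℝ E = m + 1) {n : E} (hn : ‖n‖ = 1) (z : E) {h : ℝ}
    (hh : 0 < h) {e : Set E} (he : IsCompact e) (heh : ∀ y ∈ e, inner ℝ n (y - z) = h)
    {f : E → ℝ} (hf : ContDiff ℝ 1 f) :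
    ∫ x in cone z e, ((m + 1 : ℝ) * f x + fderiv ℝ f x (x - z)) =
      h * ∫ x in e, f x ∂(Measure.euclideanHausdorffMeasure m) := by
  -- `w` is the foot of the perpendicular from the apex to the hyperplane of the base, and `e'` is
  -- the base seen from `w`.
  set w : E := z + h • n with hw
  set e' : Set (ℝ ∙ n)ᗮ := (fun y : (ℝ ∙ n)ᗮ => w + (y : E)) ⁻¹' e with he'
  have hnn : inner ℝ n n = (1 : ℝ) := by rw [real_inner_self_eq_norm_sq, hn]; norm_num
  have hew : ∀ x ∈ e, inner ℝ n (x - w) = 0 := fun x hx => by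
    rw [hw, ← sub_sub, inner_sub_right, heh x hx, inner_smul_right, hnn]; ring
  have he'c : IsCompact e' := (isometry_hyperplane w n).isClosedEmbedding.isCompact_preimage he
  set g : E → ℝ := fun x => (m + 1 : ℝ) * f x + fderiv ℝ f x (x - z) with hg
  have hgc : Continuous g := by
    have h1 := hf.continuous
    have h2 := hf.continuous_fderiv (by norm_num)
    fun_prop
  set K := cone z e with hK
  have hKc : IsCompact K := isCompact_cone z he
  have hKm : MeasurableSet K := hKc.measurableSet
  set Φ := normalCoordinates z hn with hΦ
  -- The slice of the cone at height `s` is the base scaled by `s / h`. Height `0` is excluded: the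
  -- apex lies there although `0 ∉ Ioc 0 h`. It is a null set of heights.
  have hslice : ∀ s : ℝ, s ≠ 0 → ∀ y : (ℝ ∙ n)ᗮ,
      Φ (s, y) ∈ K ↔ s ∈ Set.Ioc 0 h ∧ y ∈ (s / h) • e' := by
    intro s hs y
    have hny : inner ℝ n (y : E) = (0 : ℝ) :=
      (Submodule.mem_orthogonal_singleton_iff_inner_right).1 y.2
    rw [hΦ, normalCoordinates_apply]
    constructor
    · rintro ⟨⟨t, x⟩, ⟨⟨ht0, ht1⟩, hx⟩, hxe⟩
      have h1 : t • (x - z) = s • n + (y : E) := add_left_cancel hxe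
      have h2 : t * h = s := by
        have := congrArg (fun v => inner ℝ n v) h1
        simp only [inner_smul_right, inner_add_right, heh x hx, hnn, hny] at this
        linarith
      have ht : t ≠ 0 := by rintro rfl; simp at h2; exact hs h2.symm
      have ht0' : 0 < t := lt_of_le_of_ne ht0 ht.symm
      refine ⟨⟨by rw [← h2]; positivity, by rw [← h2]; nlinarith⟩, ?_⟩
      have h3 : s / h = t := by rw [← h2]; field_simp
      rw [h3, Set.mem_smul_set_iff_inv_smul_mem₀ ht]
      have h4 : w + ((t⁻¹ • y : (ℝ ∙ n)ᗮ) : E) = x := by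
        have h5 : (y : E) = t • (x - z) - s • n := by rw [h1]; abel
        rw [Submodule.coe_smul, h5, smul_sub, smul_smul, smul_smul, inv_mul_cancel₀ ht, one_smul,
          hw,
          ← h2, ← mul_assoc, inv_mul_cancel₀ ht, one_mul]
        abel
      change w + ((t⁻¹ • y : (ℝ ∙ n)ᗮ) : E) ∈ e
      rwa [h4]
    · rintro ⟨⟨hs0, hs1⟩, hy⟩
      obtain ⟨y', hy', rfl⟩ := hy
      refine ⟨(s / h, w + y'), ⟨⟨by positivity, (div_le_one hh).2 hs1⟩, hy'⟩, ?_⟩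
      simp only [hw, Submodule.coe_smul]
      rw [add_assoc, add_sub_cancel_left, smul_add, smul_smul, div_mul_cancel₀ _ hh.ne']
  have hmp := measurePreserving_normalCoordinates z hn
  have hgi : Integrable (fun q : ℝ × (ℝ ∙ n)ᗮ => K.indicator g (Φ q)) (volume.prod volume) := by
    have : Integrable (K.indicator g) volume :=
      (integrable_indicator_iff hKm).2 (hgc.continuousOn.integrableOn_compact hKc)
    exact hmp.integrable_comp_of_integrable this
  -- After rescaling each slice to the base, `(s / h) ^ m` is the Jacobian.
  set F : ℝ → (ℝ ∙ n)ᗮ → ℝ := fun s y => (s / h) ^ m * g (z + (s / h) • (h • n + y)) with hF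
  have hFc : Continuous (Function.uncurry F) := by
    simp only [hF, Function.uncurry_def]
    fun_prop
  have hinner : ∀ s : ℝ, s ≠ 0 → ∫ y, K.indicator g (Φ (s, y)) =
      (Set.Ioc 0 h).indicator (fun s => ∫ y in e', F s y) s := by
    intro s hs
    by_cases hsI : s ∈ Set.Ioc 0 h
    · have hsh : 0 < s / h := div_pos hsI.1 hh
      rw [Set.indicator_of_mem hsI]
      have h1 : ∀ y, K.indicator g (Φ (s, y)) =
          ((s / h) • e').indicator (fun y => g (z + (s • n + y))) y := by
        intro y
        by_cases hy : Φ (s, y) ∈ K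
        · rw [Set.indicator_of_mem hy, Set.indicator_of_mem ((hslice s hs y).1 hy).2, hΦ,
            normalCoordinates_apply]
        · rw [Set.indicator_of_notMem hy, Set.indicator_of_notMem]
          exact fun h' => hy ((hslice s hs y).2 ⟨hsI, h'⟩)
      simp_rw [h1]
      have he'm : MeasurableSet ((s / h) • e') := he'c.measurableSet.const_smul₀ _
      rw [integral_indicator he'm]
      have h2 := Measure.setIntegral_comp_smul_of_pos (volume : Measure (ℝ ∙ n)ᗮ)
        (fun y => g (z + (s • n + y))) e' hsh
      rw [finrank_orthogonal_unit hm hn] at h2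
      rw [eq_comm, hF]
      simp only
      rw [integral_const_mul]
      have h3 : ∀ y : (ℝ ∙ n)ᗮ, (s / h) • (h • n + (y : E)) =
          s • n + (((s / h) • y : (ℝ ∙ n)ᗮ) : E) := fun y => by
        rw [smul_add, smul_smul, div_mul_cancel₀ _ hh.ne', Submodule.coe_smul]
      simp_rw [h3]
      rw [h2, smul_eq_mul, ← mul_assoc, mul_inv_cancel₀ (by positivity), one_mul]
    · rw [Set.indicator_of_notMem hsI]
      have h1 : ∀ y, K.indicator g (Φ (s, y)) = 0 := fun y =>
        Set.indicator_of_notMem (fun hy => hsI ((hslice s hs y).1 hy).1) _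
      simp [h1]
  have hstep1 : ∫ x in K, g x = ∫ s in Set.Ioc 0 h, ∫ y in e', F s y := by
    rw [← integral_indicator hKm, ← hmp.integral_comp Φ.measurableEmbedding, integral_prod _ hgi,
      ← integral_indicator measurableSet_Ioc]
    refine integral_congr_ae ?_
    have : ∀ᵐ s : ℝ, s ≠ 0 := by simp [ae_iff]
    filter_upwards [this] with s hs using hinner s hs
  have hFint : Integrable (Function.uncurry F)
      ((volume.restrict (Set.Ioc 0 h)).prod (volume.restrict e')) := by
    rw [Measure.prod_restrict]
    exact (hFc.continuousOn.integrableOn_compact (isCompact_Icc.prod he'c)).mono_set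
      (Set.prod_mono Set.Ioc_subset_Icc_self subset_rfl)
  -- Along each ray from the apex the integrand is an exact derivative, of `h (s / h) ^ (m + 1) f`;
  -- only the endpoint on the base contributes.
  have hftc : ∀ y : (ℝ ∙ n)ᗮ, ∫ s in Set.Ioc 0 h, F s y = h * f (w + y) := by
    intro y
    rw [← intervalIntegral.integral_of_le hh.le]
    have hder : ∀ s ∈ Set.uIcc 0 h, HasDerivAt
        (fun s : ℝ => h * ((s / h) ^ (m + 1) * f (z + (s / h) • (h • n + y)))) (F s y) s := by
      intro s _
      have h0 : HasDerivAt (fun s : ℝ => s / h) (1 / h) s := (hasDerivAt_id s).div_const h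
      have h1 : HasDerivAt (fun s : ℝ => z + (s / h) • (h • n + (y : E)))
          ((1 / h) • (h • n + (y : E))) s := (h0.smul_const _).const_add z
      have h2 := ((hf.differentiable (by norm_num)) (z + (s / h) • (h • n + (y : E)))).hasFDerivAt
      have h3 := h2.comp_hasDerivAt s h1
      have h4 := ((h0.pow (m + 1)).mul h3).const_mul h
      refine h4.congr_deriv ?_
      simp only [hF, hg, Function.comp_apply, add_sub_cancel_left, map_smul, smul_eq_mul,
        Nat.cast_add, Nat.cast_one, Nat.add_sub_cancel, Pi.pow_apply]
      generalize s / h = r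
      field_simp
      ring
    rw [intervalIntegral.integral_eq_sub_of_hasDerivAt hder]
    · rw [div_self hh.ne', one_pow, one_mul, one_smul, zero_div, zero_pow (by omega), hw, add_assoc]
      ring
    · refine Continuous.intervalIntegrable ?_ _ _
      exact hFc.comp (by fun_prop : Continuous fun s : ℝ => (s, y))
  rw [hstep1, integral_integral_swap hFint]
  simp_rw [hftc]
  rw [integral_const_mul, setIntegral_hyperplane hm hn w he.measurableSet hew]

end Cone

/-! ### Simplices in barycentric coordinates -/

section Barycentric

open Module

variable {E : Type*} [NormedAddCommGroup E] [InnerProductSpace ℝ E]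

/-- The functions `x ↦ ⟪g i, x⟫ + c i` are the barycentric coordinates of the full-dimensional
simplex with vertex set `s`. -/
structure Barycentric (s : Finset E) (g : E → E) (c : E → ℝ) : Prop where
  one_lt_card : 1 < s.card
  sum_eq_one : ∀ x, ∑ i ∈ s, (inner ℝ (g i) x + c i) = 1
  combination : ∀ x, ∑ i ∈ s, (inner ℝ (g i) x + c i) • i = x
  vertex_self : ∀ i ∈ s, inner ℝ (g i) i + c i = 1
  vertex_ne : ∀ i ∈ s, ∀ j ∈ s, i ≠ j → inner ℝ (g i) j + c i = 0
  interior_eq : interior (convexHull ℝ (s : Set E)) = {x | ∀ i ∈ s, 0 < inner ℝ (g i) x + c i}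

lemma exists_barycentric [FiniteDimensional ℝ E] {s : Finset E}
    (hi : AffineIndependent ℝ ((↑) : s → E)) (hs : s.card = finrank ℝ E + 1)
    (hE : 0 < finrank ℝ E) : ∃ g c, Barycentric s g c := by
  classical
  have htot : affineSpan ℝ (Set.range ((↑) : s → E)) = ⊤ :=
    hi.affineSpan_eq_top_iff_card_eq_finrank_add_one.2 (by simpa using hs)
  let b : AffineBasis s ℝ E := ⟨(↑), hi, htot⟩
  let g : E → E := fun i => if h : i ∈ s then
    (InnerProductSpace.toDual ℝ E).symm (b.coord ⟨i, h⟩).linear.toContinuousLinearMap else 0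
  let c : E → ℝ := fun i => if h : i ∈ s then b.coord ⟨i, h⟩ 0 else 0
  have hlam : ∀ (i : s) (x : E), inner ℝ (g i) x + c i = b.coord i x := by
    intro i x
    simp only [g, c, i.2, dif_pos, InnerProductSpace.toDual_symm_apply]
    have := (b.coord i).map_vadd 0 x
    simpa using this.symm
  refine ⟨g, c, ⟨by omega, fun x => ?_, fun x => ?_, fun i h => ?_, fun i h j h' hij => ?_, ?_⟩⟩
  · rw [← Finset.sum_coe_sort s fun i => inner ℝ (g i) x + c i]
    simp_rw [hlam]
    exact b.sum_coord_apply_eq_one x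
  · rw [← Finset.sum_coe_sort s fun i => (inner ℝ (g i) x + c i) • i]
    simp_rw [hlam]
    exact b.linear_combination_coord_eq_self x
  · have := hlam ⟨i, h⟩ i
    rw [this]
    exact b.coord_apply_eq ⟨i, h⟩
  · have := hlam ⟨i, h⟩ j
    rw [this]
    exact b.coord_apply_ne (i := ⟨i, h⟩) (j := ⟨j, h'⟩) (by simpa using hij)
  · have h1 : (s : Set E) = Set.range b := Subtype.range_coe.symm
    rw [h1, b.interior_convexHull]
    ext x
    simp only [Set.mem_ofPred_eq]
    exact ⟨fun h i hi => (hlam ⟨i, hi⟩ x).symm ▸ h ⟨i, hi⟩, fun h i => hlam i x ▸ h i i.2⟩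

namespace Barycentric

set_option linter.unusedSectionVars false

variable {s : Finset E} {g : E → E} {c : E → ℝ} (B : Barycentric s g c)
include B

lemma vertex [DecidableEq E] {i j : E} (hi : i ∈ s) (hj : j ∈ s) :
    inner ℝ (g i) j + c i = if i = j then 1 else 0 := by
  split_ifs with h
  · subst h; exact B.vertex_self i hi
  · exact B.vertex_ne i hi j hj h

lemma coord_combination {t : Finset E} (hts : t ⊆ s) {w : E → ℝ} (hw : ∑ y ∈ t, w y = 1) {j : E}
    (hj : j ∈ s) [Decidable (j ∈ t)] :
    inner ℝ (g j) (∑ y ∈ t, w y • y) + c j = if j ∈ t then w j else 0 := by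
  classical
  calc inner ℝ (g j) (∑ y ∈ t, w y • y) + c j
      = ∑ y ∈ t, w y * (inner ℝ (g j) y + c j) := by
        simp_rw [inner_sum, inner_smul_right, mul_add, Finset.sum_add_distrib]
        rw [← Finset.sum_mul, hw, one_mul]
    _ = ∑ y ∈ t, if j = y then w y else 0 := by
        refine Finset.sum_congr rfl fun y hy => ?_
        rw [B.vertex hj (hts hy)]
        split_ifs <;> simp
    _ = _ := by rw [Finset.sum_ite_eq]; congr

/-- The barycenter of a face lies in its relative interior. -/
lemma coord_barycenter_pos {t : Finset E} (hts : t ⊆ s) {j : E} (hj : j ∈ t) :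
    0 < inner ℝ (g j) (∑ y ∈ t, (t.card : ℝ)⁻¹ • y) + c j := by
  classical
  have hc : (0 : ℝ) < t.card := by exact_mod_cast Finset.card_pos.2 ⟨j, hj⟩
  rw [B.coord_combination hts (w := fun _ => (t.card : ℝ)⁻¹) (by simp [hc.ne']) (hts hj), if_pos hj]
  exact inv_pos.2 hc

lemma mem_convexHull_iff {t : Finset E} (hts : t ⊆ s) (x : E) :
    x ∈ convexHull ℝ (t : Set E) ↔ (∀ j ∈ s, 0 ≤ inner ℝ (g j) x + c j) ∧
      ∀ j ∈ s, j ∉ t → inner ℝ (g j) x + c j = 0 := by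
  classical
  rw [Finset.mem_convexHull']
  constructor
  · rintro ⟨w, hw0, hw1, rfl⟩
    refine ⟨fun j hj => ?_, fun j hj hjt => ?_⟩
    · rw [B.coord_combination hts hw1 hj]
      split_ifs with h
      exacts [hw0 j h, le_rfl]
    · rw [B.coord_combination hts hw1 hj, if_neg hjt]
  · rintro ⟨h0, h1⟩
    refine ⟨fun j => inner ℝ (g j) x + c j, fun j hj => h0 j (hts hj), ?_, ?_⟩
    · rw [← B.sum_eq_one x]
      exact Finset.sum_subset hts fun j hj hjt => h1 j hj hjt
    · conv_rhs => rw [← B.combination x]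
      refine Finset.sum_subset hts fun j hj hjt => ?_
      simp only [h1 j hj hjt, zero_smul]

lemma mem_cell_iff (x : E) :
    x ∈ convexHull ℝ (s : Set E) ↔ ∀ j ∈ s, 0 ≤ inner ℝ (g j) x + c j := by
  rw [B.mem_convexHull_iff subset_rfl]
  exact ⟨fun h => h.1, fun h => ⟨h, fun j hj hj' => absurd hj hj'⟩⟩

lemma mem_interior_iff (x : E) :
    x ∈ interior (convexHull ℝ (s : Set E)) ↔ ∀ j ∈ s, 0 < inner ℝ (g j) x + c j := by
  rw [B.interior_eq, Set.mem_ofPred_eq]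

lemma sum_const : ∑ i ∈ s, c i = 1 := by simpa using B.sum_eq_one 0

lemma sum_inner_grad (x : E) : ∑ i ∈ s, inner ℝ (g i) x = (0 : ℝ) := by
  have := B.sum_eq_one x
  rw [Finset.sum_add_distrib, B.sum_const] at this
  linarith

/-- This is the linear part of `combination`. Together with `∑ g i = 0` it is a resolution of the
identity, `∑ i ⊗ g i = 1`, which replaces orthonormal bases in what follows. -/
lemma sum_inner_smul (x : E) : ∑ i ∈ s, inner ℝ (g i) x • i = x := by
  have h0 := B.combination 0
  have h := B.combination x
  simp only [inner_zero_right, zero_add, add_smul, Finset.sum_add_distrib] at h0 h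
  rwa [h0, add_zero] at h

lemma grad_ne_zero {i : E} (hi : i ∈ s) : g i ≠ 0 := by
  intro h
  obtain ⟨j, hj, hji⟩ := Finset.exists_mem_ne B.one_lt_card i
  have h1 := B.vertex_self i hi
  have h2 := B.vertex_ne i hi j hj hji.symm
  rw [h, inner_zero_left] at h1 h2
  linarith

/-- A vector which is orthogonal to a facet is a multiple of the gradient of the opposite
coordinate. -/
lemma eq_smul_grad {i : E} (hi : i ∈ s) {n : E} {a : ℝ}
    (hn : ∀ j ∈ s, j ≠ i → inner ℝ n j = a) : n = (inner ℝ n i - a) • g i := by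
  refine ext_inner_right ℝ fun v => ?_
  conv_lhs => rw [← B.sum_inner_smul v]
  -- Since the `g j` sum to zero, `a` may be subtracted from every coefficient, which leaves only
  -- the term `j = i`.
  have h0 : ∑ j ∈ s, inner ℝ (g j) v * a = 0 := by
    rw [← Finset.sum_mul, B.sum_inner_grad, zero_mul]
  rw [inner_sum, real_inner_smul_left, ← sub_zero (∑ j ∈ s, _), ← h0, ← Finset.sum_sub_distrib,
    Finset.sum_eq_single i]
  · rw [inner_smul_right]; ring
  · intro j hj hji
    rw [inner_smul_right, hn j hj hji, sub_self]
  · exact fun h => absurd hi h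

/-- Entering a simplex through the relative interior of one of its facets. -/
lemma eventually_mem_interior {i : E} {x v : E}
    (hx0 : inner ℝ (g i) x + c i = 0) (hx : ∀ j ∈ s, j ≠ i → 0 < inner ℝ (g j) x + c j)
    (hv : 0 < inner ℝ (g i) v) :
    ∀ᶠ δ : ℝ in 𝓝[>] 0, x + δ • v ∈ interior (convexHull ℝ (s : Set E)) := by
  simp_rw [B.mem_interior_iff]
  rw [Filter.eventually_all_finset]
  intro j hj
  by_cases hji : j = i
  · subst hji
    filter_upwards [self_mem_nhdsWithin] with δ hδ
    have hδ' : 0 < δ := hδ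
    rw [inner_add_right, inner_smul_right]
    have := mul_pos hδ' hv
    linarith
  · have hcont : Continuous fun δ : ℝ => inner ℝ (g j) (x + δ • v) + c j := by fun_prop
    have := hcont.tendsto 0
    simp only [zero_smul, add_zero] at this
    exact (this.eventually (lt_mem_nhds (hx j hj hji))).filter_mono nhdsWithin_le_nhds

variable [FiniteDimensional ℝ E] [MeasurableSpace E] [BorelSpace E]

omit [FiniteDimensional ℝ E] [MeasurableSpace E] [BorelSpace E] in
lemma mem_facet_iff [DecidableEq E] {i : E} (hi : i ∈ s) (x : E) :
    x ∈ convexHull ℝ ((s.erase i : Finset E) : Set E) ↔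
      (∀ j ∈ s, 0 ≤ inner ℝ (g j) x + c j) ∧ inner ℝ (g i) x + c i = 0 := by
  rw [B.mem_convexHull_iff (Finset.erase_subset i s)]
  refine and_congr_right fun _ => ⟨fun h => h i hi (Finset.notMem_erase i s), fun h j hj hji => ?_⟩
  have : j = i := by
    by_contra hne
    exact hji (Finset.mem_erase.2 ⟨hne, hj⟩)
  rw [this, h]

omit [FiniteDimensional ℝ E] [MeasurableSpace E] [BorelSpace E] in
lemma cone_facet [DecidableEq E] {i : E} (hi : i ∈ s) :
    cone i (convexHull ℝ ((s.erase i : Finset E) : Set E)) = convexHull ℝ (s : Set E) := by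
  have hne : ((s.erase i : Finset E) : Set E).Nonempty := by
    obtain ⟨j, hj, hji⟩ := Finset.exists_mem_ne B.one_lt_card i
    exact ⟨j, Finset.mem_coe.2 (Finset.mem_erase.2 ⟨hji, hj⟩)⟩
  conv_rhs => rw [← Finset.insert_erase hi, Finset.coe_insert, convexHull_insert hne,
    convexJoin_singleton_left]
  ext x
  simp only [Set.mem_iUnion, segment_eq_image', cone, Set.mem_image, Set.mem_prod, Prod.exists,
    exists_prop]
  constructor
  · rintro ⟨t, y, ⟨ht, hy⟩, rfl⟩
    exact ⟨y, hy, t, ht, rfl⟩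
  · rintro ⟨y, hy, t, ht, rfl⟩
    exact ⟨t, y, ⟨ht, hy⟩, rfl⟩

omit B [FiniteDimensional ℝ E] [MeasurableSpace E] [BorelSpace E] in
lemma isCompact_convexHull_finset (t : Finset E) : IsCompact (convexHull ℝ (t : Set E)) :=
  t.finite_toSet.isCompact_convexHull (𝕜 := ℝ)

/-- The coordinate of `i` falls from `1` at the apex to `0` on the opposite facet with slope `‖g
i‖`, so the cone has height `‖g i‖⁻¹`. The minus sign in the normal makes it point from the apex to
the base. -/
lemma integral_facet [DecidableEq E] {m : ℕ} (hm : finrank ℝ E = m + 1) {i : E} (hi : i ∈ s)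
    {f : E → ℝ} (hf : ContDiff ℝ 1 f) :
    ∫ x in convexHull ℝ (s : Set E), ((m + 1 : ℝ) * f x + fderiv ℝ f x (x - i)) =
      ‖g i‖⁻¹ * ∫ x in convexHull ℝ ((s.erase i : Finset E) : Set E), f x
        ∂(Measure.euclideanHausdorffMeasure m) := by
  have hg := norm_pos_iff.2 (B.grad_ne_zero hi)
  have hn : ‖-(‖g i‖⁻¹ • g i)‖ = 1 := by
    rw [norm_neg, norm_smul, norm_inv, norm_norm, inv_mul_cancel₀ hg.ne']
  rw [← B.cone_facet hi]
  refine integral_cone hm hn i (inv_pos.2 hg) (isCompact_convexHull_finset _) (fun y hy => ?_) hf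
  have h1 := ((B.mem_facet_iff hi y).1 hy).2
  have h2 := B.vertex_self i hi
  rw [inner_neg_left, real_inner_smul_left, inner_sub_right]
  have : inner ℝ (g i) y - inner ℝ (g i) i = -1 := by linarith
  rw [this]; ring

/-- The divergence theorem on a simplex; `‖g i‖⁻¹ • g i` is the unit inward normal on the facet
opposite to the vertex `i`. -/
theorem divergence_theorem [DecidableEq E] {m : ℕ} (hm : finrank ℝ E = m + 1) {W : E → E}
    (hW : ContDiff ℝ 1 W) :
    ∑ i ∈ s, ∫ x in convexHull ℝ ((s.erase i : Finset E) : Set E),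
        inner ℝ (‖g i‖⁻¹ • g i) (W x) ∂(Measure.euclideanHausdorffMeasure m) =
      -∫ x in convexHull ℝ (s : Set E), ∑ i ∈ s, inner ℝ (g i) (fderiv ℝ W x i) := by
  have hf : ∀ i, ContDiff ℝ 1 fun x => inner ℝ (g i) (W x) := fun i => contDiff_const.inner ℝ hW
  -- Here `W = -∑ ⟪g i, W⟫ (x - i)`, and the `i`-th summand is radial from the vertex `i`: its only
  -- flux is through the opposite facet.
  have h1 : ∀ i ∈ s, ∫ x in convexHull ℝ ((s.erase i : Finset E) : Set E),
        inner ℝ (‖g i‖⁻¹ • g i) (W x) ∂(Measure.euclideanHausdorffMeasure m) =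
      ∫ x in convexHull ℝ (s : Set E), ((m + 1 : ℝ) * inner ℝ (g i) (W x) +
        fderiv ℝ (fun x => inner ℝ (g i) (W x)) x (x - i)) := by
    intro i hi
    rw [B.integral_facet hm hi (hf i), ← integral_const_mul]
    simp_rw [real_inner_smul_left]
  rw [Finset.sum_congr rfl h1, ← integral_finsetSum, ← integral_neg]
  · congr 1
    ext x
    have h2 : ∀ i v, fderiv ℝ (fun x => inner ℝ (g i) (W x)) x v =
        inner ℝ (g i) (fderiv ℝ W x v) := by
      intro i v
      rw [fderiv_inner_apply ℝ (differentiableAt_const _) (hW.differentiable (by norm_num) x)]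
      simp
    -- Because `∑ g i = 0`, the `m + 1` terms and the derivatives in the direction `x` drop out of
    -- the sum.
    simp_rw [h2, map_sub, inner_sub_right]
    rw [Finset.sum_add_distrib, Finset.sum_sub_distrib, ← Finset.mul_sum, B.sum_inner_grad,
      B.sum_inner_grad]
    ring
  · intro i _
    refine ContinuousOn.integrableOn_compact (isCompact_convexHull_finset s)
      (Continuous.continuousOn ?_)
    have h3 := (hf i).continuous
    have h4 := (hf i).continuous_fderiv (by norm_num)
    fun_prop

omit B [MeasurableSpace E] [BorelSpace E] in
lemma unit_grad {v : E} (hv : v ≠ 0) : ‖‖v‖⁻¹ • v‖ = 1 := by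
  rw [norm_smul, norm_inv, norm_norm, inv_mul_cancel₀ (norm_ne_zero_iff.2 hv)]

omit [FiniteDimensional ℝ E] [MeasurableSpace E] [BorelSpace E] in
lemma facet_subset_hyperplane [DecidableEq E] {i k : E} (hi : i ∈ s) (hk : k ∈ s) (hki : k ≠ i) :
    ∀ x ∈ convexHull ℝ ((s.erase i : Finset E) : Set E), inner ℝ (‖g i‖⁻¹ • g i) (x - k) = 0 := by
  intro x hx
  have h1 := ((B.mem_facet_iff hi x).1 hx).2
  have h2 := B.vertex_ne i hi k hk hki.symm
  rw [real_inner_smul_left, inner_sub_right]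
  have : inner ℝ (g i) x - inner ℝ (g i) k = 0 := by linarith
  rw [this, mul_zero]

lemma measure_facet_lt_top [DecidableEq E] {m : ℕ} (hm : finrank ℝ E = m + 1) {i : E} (hi : i ∈ s) :
    Measure.euclideanHausdorffMeasure m (convexHull ℝ ((s.erase i : Finset E) : Set E)) < ⊤ := by
  obtain ⟨k, hk, hki⟩ := Finset.exists_mem_ne B.one_lt_card i
  rw [measure_hyperplane hm (unit_grad (B.grad_ne_zero hi)) k
    (isCompact_convexHull_finset _).measurableSet (B.facet_subset_hyperplane hi hk hki)]
  exact ((isometry_hyperplane k _).isClosedEmbedding.isCompact_preimage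
    (isCompact_convexHull_finset _)).measure_lt_top

lemma integrableOn_facet [DecidableEq E] {m : ℕ} (hm : finrank ℝ E = m + 1) {i : E} (hi : i ∈ s)
    {f : E → ℝ} (hf : ContinuousOn f (convexHull ℝ ((s.erase i : Finset E) : Set E))) :
    IntegrableOn f (convexHull ℝ ((s.erase i : Finset E) : Set E))
      (Measure.euclideanHausdorffMeasure m) := by
  have hc := isCompact_convexHull_finset (s.erase i)
  obtain ⟨C, hC⟩ := hc.exists_bound_of_continuousOn hf
  have : IsFiniteMeasure ((Measure.euclideanHausdorffMeasure m).restrict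
      (convexHull ℝ ((s.erase i : Finset E) : Set E))) :=
    ⟨by simpa using B.measure_facet_lt_top hm hi⟩
  exact Integrable.of_bound (hf.aestronglyMeasurable hc.measurableSet) C
    ((ae_restrict_iff' hc.measurableSet).2 (Filter.Eventually.of_forall hC))

/-- Almost every point of a facet lies in its relative interior. -/
lemma ae_facet_pos [DecidableEq E] {m : ℕ} (hm : finrank ℝ E = m + 1) {i : E} (hi : i ∈ s) :
    ∀ᵐ x ∂((Measure.euclideanHausdorffMeasure m).restrict
      (convexHull ℝ ((s.erase i : Finset E) : Set E))),
      ∀ j ∈ s, j ≠ i → 0 < inner ℝ (g j) x + c j := by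
  have hc := isCompact_convexHull_finset (s.erase i)
  have key : ∀ j ∈ s, ∀ᵐ x ∂((Measure.euclideanHausdorffMeasure m).restrict
      (convexHull ℝ ((s.erase i : Finset E) : Set E))), j ≠ i → 0 < inner ℝ (g j) x + c j := by
    intro j hj
    by_cases hji : j = i
    · simp [hji]
    have hN : Measure.euclideanHausdorffMeasure m
        (convexHull ℝ ((s.erase i : Finset E) : Set E) ∩ {x | inner ℝ (g j) x + c j = 0}) = 0 := by
      have hcl : IsClosed {x | inner ℝ (g j) x + c j = 0} :=
        isClosed_eq (by fun_prop) continuous_const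
      rw [measure_hyperplane hm (unit_grad (B.grad_ne_zero hi)) j
        (hc.measurableSet.inter hcl.measurableSet)
        fun x hx => B.facet_subset_hyperplane hi hj hji x hx.1]
      set n := ‖g i‖⁻¹ • g i with hn
      let L : (ℝ ∙ n)ᗮ →ₗ[ℝ] ℝ := (innerₛₗ ℝ (g j)).comp (ℝ ∙ n)ᗮ.subtype
      let A : AffineSubspace ℝ (ℝ ∙ n)ᗮ :=
        (AffineSubspace.mk' (-1 : ℝ) ⊥).comap L.toAffineMap
      have hA : ∀ y : (ℝ ∙ n)ᗮ, y ∈ A ↔ inner ℝ (g j) (y : E) = -1 := by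
        intro y
        simp only [A, AffineSubspace.mem_comap, AffineSubspace.mem_mk', Submodule.mem_bot,
          vsub_eq_sub, sub_eq_zero]
        rfl
      -- The origin of the parametrization is the vertex `j`, where the coordinate of `j` is `1`;
      -- its zero set is therefore a proper affine subspace, hence null.
      have hAtop : A ≠ ⊤ := by
        intro h
        have h0 := (hA 0).1 (h ▸ AffineSubspace.mem_top ℝ _ _)
        simp at h0
      refine measure_mono_null ?_ (Measure.addHaar_affineSubspace volume A hAtop)
      rintro y ⟨-, hy⟩
      refine (hA y).2 ?_
      have h1 := B.vertex_self j hj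
      simp only [Set.mem_ofPred_eq, inner_add_right] at hy
      linarith
    rw [ae_restrict_iff' hc.measurableSet, ae_iff]
    refine measure_mono_null ?_ hN
    intro x hx
    simp only [Set.mem_ofPred_eq, Classical.not_imp, not_lt] at hx
    exact ⟨hx.1, le_antisymm hx.2.2 (((B.mem_facet_iff hi x).1 hx.1).1 j hj)⟩
  exact (Filter.eventually_all_finset s).2 key

end Barycentric

end Barycentric

/-! ### Facets of a conformal mesh -/

section Mesh

open Classical in
/-- The gradients of the barycentric coordinates of a simplex. -/
noncomputable def baryGrad {d : ℕ} (s : Finset (Space d)) : Space d → Space d :=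
  if h : ∃ g c, Barycentric s g c then h.choose else 0

open Classical in
/-- The constant terms of the barycentric coordinates of a simplex. -/
noncomputable def baryConst {d : ℕ} (s : Finset (Space d)) : Space d → ℝ :=
  if h : ∃ g c, Barycentric s g c then h.choose_spec.choose else 0

/-- The unit normal on the facet of `s` opposite to the vertex `i`, pointing into `s`. -/
noncomputable def inwardNormal {d : ℕ} (s : Finset (Space d)) (i : Space d) : Space d :=
  ‖baryGrad s i‖⁻¹ • baryGrad s i

namespace ConformalMesh

variable {d : ℕ} {D : Set (Space d)} (M : ConformalMesh d D)

lemma mem_elements {s : Finset (Space d)} :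
    s ∈ M.elements ↔ s ∈ M.complex.faces ∧ s.card = d + 1 := by
  rw [elements, Finset.mem_filter, Set.Finite.mem_toFinset]

variable {M}

lemma barycentric (hd : 0 < d) {s : Finset (Space d)} (hs : s ∈ M.elements) :
    Barycentric s (baryGrad s) (baryConst s) := by
  have h : ∃ g c, Barycentric s g c :=
    exists_barycentric (M.complex.indep (M.mem_elements.1 hs).1)
      (by simpa using (M.mem_elements.1 hs).2) (by simpa using hd)
  rw [baryGrad, baryConst, dif_pos h, dif_pos h]
  exact h.choose_spec.choose_spec

lemma cell_subset_closure {s : Finset (Space d)} (hs : s ∈ M.elements) : cell s ⊆ closure D := by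
  rw [← M.space_eq]
  exact M.complex.convexHull_subset_space (M.mem_elements.1 hs).1

lemma interior_cell_subset {s : Finset (Space d)} (hs : s ∈ M.elements) :
    interior (cell s) ⊆ D :=
  M.interior_subset s (M.mem_elements.1 hs).1 (M.mem_elements.1 hs).2

lemma exists_mem_cell {x : Space d} (hx : x ∈ closure D) : ∃ s ∈ M.elements, x ∈ cell s := by
  rw [← M.space_eq, Geometry.SimplicialComplex.mem_space_iff] at hx
  obtain ⟨s, hs, hxs⟩ := hx
  obtain ⟨t, ht, hst, htc⟩ := M.pure s hs
  exact ⟨t, M.mem_elements.2 ⟨ht, htc⟩, convexHull_mono (Finset.coe_subset.2 hst) hxs⟩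

lemma isCompact_cell (s : Finset (Space d)) : IsCompact (cell s) :=
  Barycentric.isCompact_convexHull_finset s

/-- The coordinate of `s` opposite to a vertex which is not in `t` vanishes on the intersection of
the elements `s` and `t`. -/
lemma coord_eq_zero_of_mem (hd : 0 < d) {s t : Finset (Space d)} (hs : s ∈ M.elements)
    (ht : t ∈ M.elements) {x : Space d} (hxs : x ∈ cell s) (hxt : x ∈ cell t) {j : Space d}
    (hj : j ∈ s) (hjt : j ∉ t) : inner ℝ (baryGrad s j) x + baryConst s j = 0 := by
  classical
  have h := M.complex.inter_subset_convexHull (M.mem_elements.1 hs).1 (M.mem_elements.1 ht).1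
    ⟨hxs, hxt⟩
  rw [← Finset.coe_inter, (barycentric hd hs).mem_convexHull_iff Finset.inter_subset_left] at h
  exact h.2 j hj fun h' => hjt (Finset.mem_inter.1 h').2

lemma exists_mem_notMem {s t : Finset (Space d)} (hs : s ∈ M.elements)
    (ht : t ∈ M.elements) (hst : s ≠ t) : ∃ j ∈ s, j ∉ t := by
  by_contra! h
  exact hst (Finset.eq_of_subset_of_card_le h
    ((M.mem_elements.1 ht).2.trans (M.mem_elements.1 hs).2.symm).le)

/-- Two distinct elements have equally many vertices, so `s` has a vertex outside `t`. By conformity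
its coordinate vanishes on the intersection, whereas it is positive in the interior of `s`. -/
lemma notMem_cell_of_mem_interior (hd : 0 < d) {s t : Finset (Space d)} (hs : s ∈ M.elements)
    (ht : t ∈ M.elements) (hst : s ≠ t) {x : Space d} (hx : x ∈ interior (cell s)) :
    x ∉ cell t := by
  intro hxt
  obtain ⟨j, hj, hjt⟩ := exists_mem_notMem hs ht hst
  have h1 := coord_eq_zero_of_mem hd hs ht (_root_.interior_subset hx) hxt hj hjt
  have h2 := ((barycentric hd hs).mem_interior_iff x).1 hx j hj
  exact h2.ne' h1

lemma norm_inwardNormal (hd : 0 < d) {s : Finset (Space d)} (hs : s ∈ M.elements) {i : Space d}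
    (hi : i ∈ s) : ‖inwardNormal s i‖ = 1 :=
  Barycentric.unit_grad ((barycentric hd hs).grad_ne_zero hi)

lemma inwardNormal_pos_iff (hd : 0 < d) {s : Finset (Space d)} (hs : s ∈ M.elements) {i : Space d}
    (hi : i ∈ s) (v : Space d) :
    0 < inner ℝ (inwardNormal s i) v ↔ 0 < inner ℝ (baryGrad s i) v := by
  rw [inwardNormal, real_inner_smul_left]
  exact mul_pos_iff_of_pos_left
    (inv_pos.2 (norm_pos_iff.2 ((barycentric hd hs).grad_ne_zero hi)))

/-- The points of a facet which lie on no smaller face. -/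
def facetInterior (s : Finset (Space d)) (i : Space d) : Set (Space d) :=
  {x | inner ℝ (baryGrad s i) x + baryConst s i = 0 ∧
    ∀ j ∈ s, j ≠ i → 0 < inner ℝ (baryGrad s j) x + baryConst s j}

lemma eventually_mem_interior (hd : 0 < d) {s : Finset (Space d)} (hs : s ∈ M.elements)
    {i x v : Space d} (hi : i ∈ s) (hx : x ∈ facetInterior s i)
    (hv : 0 < inner ℝ (inwardNormal s i) v) :
    ∀ᶠ δ : ℝ in 𝓝[>] 0, x + δ • v ∈ interior (cell s) :=
  (barycentric hd hs).eventually_mem_interior hx.1 hx.2 ((inwardNormal_pos_iff hd hs hi v).1 hv)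

open Classical in
lemma exists_eq_erase {s e : Finset (Space d)} (hs : s ∈ M.elements) (he : e.card = d)
    (hes : e ⊆ s) : ∃ i ∈ s, s.erase i = e := by
  rw [← Finset.covBy_iff_exists_erase, Finset.covBy_iff_card_sdiff_eq_one]
  refine ⟨hes, ?_⟩
  rw [Finset.card_sdiff_of_subset hes, (M.mem_elements.1 hs).2, he]
  omega

open Classical in
/-- The inward normals of two elements on a common facet are opposite. -/
lemma inwardNormal_neighbor (hd : 0 < d) {s t : Finset (Space d)} (hs : s ∈ M.elements)
    (ht : t ∈ M.elements) (hst : s ≠ t) {i k : Space d} (hi : i ∈ s) (hk : k ∈ t)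
    (hik : s.erase i = t.erase k) : inwardNormal t k = -inwardNormal s i := by
  have Bs := barycentric hd hs
  have Bt := barycentric hd ht
  have hsub : s.erase i ⊆ s := Finset.erase_subset i s
  have hsubt : s.erase i ⊆ t := hik ▸ Finset.erase_subset k t
  have hcard : (0 : ℝ) < (s.erase i).card := by
    rw [Finset.card_erase_of_mem hi, (M.mem_elements.1 hs).2]
    exact_mod_cast hd
  have hsum : ∑ y ∈ s.erase i, ((s.erase i).card : ℝ)⁻¹ = 1 := by simp [hcard.ne']
  -- The barycenter of the common facet lies in its relative interior as seen from either element. A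
  -- direction pointing into both would give a point interior to both.
  set x := ∑ y ∈ s.erase i, ((s.erase i).card : ℝ)⁻¹ • y with hx
  have hxs : x ∈ facetInterior s i := by
    refine ⟨?_, fun j hj hji => Bs.coord_barycenter_pos hsub (Finset.mem_erase.2 ⟨hji, hj⟩)⟩
    rw [Bs.coord_combination hsub hsum hi, if_neg (Finset.notMem_erase i s)]
  have hxt : x ∈ facetInterior t k := by
    refine ⟨?_, fun j hj hjk => Bt.coord_barycenter_pos hsubt (hik ▸ Finset.mem_erase.2 ⟨hjk, hj⟩)⟩
    rw [Bt.coord_combination hsubt hsum hk, if_neg (hik ▸ Finset.notMem_erase k t)]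
  have hopp : ∀ v, 0 < inner ℝ (inwardNormal s i) v → ¬ 0 < inner ℝ (inwardNormal t k) v := by
    intro v h1 h2
    obtain ⟨δ, hδ1, hδ2⟩ := ((eventually_mem_interior hd hs hi hxs h1).and
      (eventually_mem_interior hd ht hk hxt h2)).exists
    exact notMem_cell_of_mem_interior hd hs ht hst hδ1 (_root_.interior_subset hδ2)
  -- On the vertices of the common facet the coordinate of `k` in `t` vanishes, so its linear part
  -- has the constant value `-baryConst t k` there.
  obtain ⟨b, hb⟩ : ∃ b : ℝ, baryGrad t k = b • baryGrad s i := by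
    refine ⟨_, Bs.eq_smul_grad hi (a := -baryConst t k) fun j hj hji => ?_⟩
    have hj' : j ∈ t.erase k := hik ▸ Finset.mem_erase.2 ⟨hji, hj⟩
    have := Bt.vertex_ne k hk j (Finset.mem_of_mem_erase hj') (Finset.ne_of_mem_erase hj').symm
    linarith
  have hg := Bs.grad_ne_zero hi
  have hgn := norm_pos_iff.2 hg
  have hb0 : b ≠ 0 := by
    rintro rfl
    exact Bt.grad_ne_zero hk (by rw [hb, zero_smul])
  have hbneg : b < 0 := by
    by_contra hcon
    have hbpos : 0 < b := lt_of_le_of_ne (not_lt.1 hcon) hb0.symm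
    refine hopp (baryGrad s i) ?_ ?_
    · rw [inwardNormal_pos_iff hd hs hi]
      exact real_inner_self_pos.2 hg
    · rw [inwardNormal_pos_iff hd ht hk, hb, real_inner_smul_left]
      exact mul_pos hbpos (real_inner_self_pos.2 hg)
  rw [inwardNormal, inwardNormal, hb, norm_smul, Real.norm_of_nonpos hbneg.le, smul_smul,
    ← neg_smul]
  congr 1
  field_simp

open Classical in
/-- Up to orientation, `faceNormal` is the normal of the adjacent elements. -/
lemma abs_inner_faceNormal (hd : 0 < d) {s : Finset (Space d)} (hs : s ∈ M.elements)
    {i : Space d} (hi : i ∈ s) (v : Space d) :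
    |inner ℝ v (faceNormal (s.erase i))| = |inner ℝ (inwardNormal s i) v| := by
  have B := barycentric hd hs
  have hex : ∃ n : Space d, ‖n‖ = 1 ∧
      n ∈ (vectorSpan ℝ ((s.erase i : Finset (Space d)) : Set (Space d)))ᗮ := by
    refine ⟨inwardNormal s i, norm_inwardNormal hd hs hi, ?_⟩
    rw [Submodule.mem_orthogonal', vectorSpan]
    intro w hw
    induction hw using Submodule.span_induction with
    | mem x hx =>
      obtain ⟨y, hy, z, hz, rfl⟩ := hx
      have hy' := Finset.mem_erase.1 (Finset.mem_coe.1 hy)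
      have hz' := Finset.mem_erase.1 (Finset.mem_coe.1 hz)
      have h1 := B.vertex_ne i hi y hy'.2 hy'.1.symm
      have h2 := B.vertex_ne i hi z hz'.2 hz'.1.symm
      simp only [vsub_eq_sub]
      rw [inwardNormal, real_inner_smul_left, inner_sub_right]
      have : inner ℝ (baryGrad s i) y - inner ℝ (baryGrad s i) z = 0 := by linarith
      rw [this, mul_zero]
    | zero => exact inner_zero_right _
    | add x y _ _ hx hy => rw [inner_add_right, hx, hy, add_zero]
    | smul a x _ hx => rw [inner_smul_right, hx, mul_zero]
  rw [faceNormal, dif_pos hex]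
  obtain ⟨hn1, hn⟩ := hex.choose_spec
  set n := hex.choose
  obtain ⟨k, hk, hki⟩ := Finset.exists_mem_ne B.one_lt_card i
  -- The chosen normal has constant inner product with the facet vertices, hence is a multiple of
  -- `baryGrad s i`; having unit length, it is determined up to sign.
  have hn' : n = (inner ℝ n i - inner ℝ n k) • baryGrad s i := by
    refine B.eq_smul_grad hi fun j hj hji => ?_
    have hjk : j - k ∈ vectorSpan ℝ ((s.erase i : Finset (Space d)) : Set (Space d)) :=
      vsub_mem_vectorSpan ℝ (Finset.mem_coe.2 (Finset.mem_erase.2 ⟨hji, hj⟩))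
        (Finset.mem_coe.2 (Finset.mem_erase.2 ⟨hki, hk⟩))
    have := (Submodule.mem_orthogonal' _ _).1 hn _ hjk
    rw [inner_sub_right] at this
    linarith
  set b := inner ℝ n i - inner ℝ n k
  have hgn := norm_pos_iff.2 (B.grad_ne_zero hi)
  have hb : |b| = ‖baryGrad s i‖⁻¹ := by
    rw [hn', norm_smul, Real.norm_eq_abs] at hn1
    exact eq_inv_of_mul_eq_one_left hn1
  rw [hn', inwardNormal, real_inner_comm, real_inner_smul_left, real_inner_smul_left,
    abs_mul, abs_mul, hb, abs_of_pos (inv_pos.2 hgn)]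

open Classical in
/-- A facet with a single adjacent element lies on the boundary of the domain. -/
lemma mem_frontier_of_boundary_facet (hd : 0 < d) (hD : IsOpen D) {s : Finset (Space d)}
    (hs : s ∈ M.elements) {i : Space d} (hi : i ∈ s)
    (hb : ∀ t ∈ M.elements, s.erase i ⊆ t → t = s) {x : Space d}
    (hxc : x ∈ cell s) (hx : x ∈ facetInterior s i) : x ∈ frontier D := by
  have B := barycentric hd hs
  rw [hD.frontier_eq]
  refine ⟨cell_subset_closure hs hxc, fun hxD => ?_⟩
  set T : Set (Space d) := ⋃ t ∈ M.elements.erase s, cell t with hT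
  have hTc : IsClosed T := by
    refine Set.Finite.isClosed_biUnion (Finset.finite_toSet _) fun t _ => ?_
    exact (isCompact_cell t).isClosed
  have hcont : Filter.Tendsto (fun δ : ℝ => x + δ • (-baryGrad s i)) (𝓝[>] 0) (𝓝 x) := by
    have : Continuous fun δ : ℝ => x + δ • (-baryGrad s i) := by fun_prop
    have h := this.tendsto 0
    simp only [zero_smul, add_zero] at h
    exact h.mono_left nhdsWithin_le_nhds
  -- If `x` were in `D`, small outward displacements would leave `s` but stay in `D`, hence in the
  -- other elements. Their union is closed, so `x` lies in one of them, which by conformity contains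
  -- the whole facet.
  have hev : ∀ᶠ δ : ℝ in 𝓝[>] 0, x + δ • (-baryGrad s i) ∈ T := by
    filter_upwards [hcont.eventually (hD.mem_nhds hxD), self_mem_nhdsWithin] with δ hδD hδ
    obtain ⟨t, ht, hxt⟩ := exists_mem_cell (M := M) (subset_closure hδD)
    refine Set.mem_biUnion (Finset.mem_coe.2 (Finset.mem_erase.2 ⟨?_, ht⟩)) hxt
    rintro rfl
    have h1 := (B.mem_cell_iff _).1 hxt i hi
    rw [inner_add_right, inner_smul_right, inner_neg_right] at h1
    have h2 := mul_pos (show (0 : ℝ) < δ from hδ) (real_inner_self_pos.2 (B.grad_ne_zero hi))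
    have h3 := hx.1
    linarith
  have hxT : x ∈ T := hTc.mem_of_tendsto hcont hev
  obtain ⟨t, ht, hxt⟩ := Set.mem_iUnion₂.1 hxT
  obtain ⟨hts, htM⟩ := Finset.mem_erase.1 ht
  refine hts (hb t htM fun j hj => ?_)
  obtain ⟨hji, hjs⟩ := Finset.mem_erase.1 hj
  by_contra hjt
  exact (hx.2 j hjs hji).ne' (coord_eq_zero_of_mem hd hs htM hxc hxt hjs hjt)

lemma mem_internalFaces {e : Finset (Space d)} : e ∈ M.internalFaces ↔ e ∈ M.complex.faces ∧
    e.card = d ∧ ∃ s ∈ M.elements, ∃ t ∈ M.elements, s ≠ t ∧ e ⊆ s ∧ e ⊆ t := by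
  rw [internalFaces, Finset.mem_filter, Set.Finite.mem_toFinset]

open Classical in
/-- An internal facet has exactly two adjacent elements. -/
lemma elements_filter_internalFace (hd : 0 < d) {e : Finset (Space d)} (he : e ∈ M.internalFaces) :
    ∃ s ∈ M.elements, ∃ t ∈ M.elements, ∃ i ∈ s, ∃ k ∈ t, s ≠ t ∧ s.erase i = e ∧ t.erase k = e ∧
      M.elements.filter (e ⊆ ·) = {s, t} := by
  obtain ⟨-, hec, s, hs, t, ht, hst, hes, het⟩ := mem_internalFaces.1 he
  obtain ⟨i, hi, hie⟩ := exists_eq_erase hs hec hes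
  obtain ⟨k, hk, hke⟩ := exists_eq_erase ht hec het
  refine ⟨s, hs, t, ht, i, hi, k, hk, hst, hie, hke, ?_⟩
  ext r
  simp only [Finset.mem_filter, Finset.mem_insert, Finset.mem_singleton]
  constructor
  · rintro ⟨hr, her⟩
    by_contra! hne
    obtain ⟨l, hl, hle⟩ := exists_eq_erase hr hec her
    -- With a third element, three unit normals would be pairwise opposite, which forces them to
    -- vanish.
    have h1 := inwardNormal_neighbor hd hs ht hst hi hk (hie.trans hke.symm)
    have h2 := inwardNormal_neighbor hd hs hr hne.1.symm hi hl (hie.trans hle.symm)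
    have h3 := inwardNormal_neighbor hd ht hr hne.2.symm hk hl (hke.trans hle.symm)
    rw [h1, h2, neg_neg] at h3
    have h4 := norm_inwardNormal hd hs hi
    have h5 : inwardNormal s i = 0 := by
      have h6 : (2 : ℝ) • inwardNormal s i = 0 := by
        rw [two_smul]; nth_rewrite 1 [← h3]; exact neg_add_cancel _
      exact (smul_eq_zero.1 h6).resolve_left two_ne_zero
    rw [h5, norm_zero] at h4
    exact zero_ne_one h4
  · rintro (rfl | rfl)
    exacts [⟨hs, hes⟩, ⟨ht, het⟩]

/-- Almost every point of a facet lies in its relative interior. -/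
lemma ae_mem_facetInterior [DecidableEq (Space d)] (hd : 0 < d) {s : Finset (Space d)}
    (hs : s ∈ M.elements) {i : Space d} (hi : i ∈ s) :
    ∀ᵐ x ∂((Measure.euclideanHausdorffMeasure (d - 1)).restrict (cell (s.erase i))),
      x ∈ cell s ∧ x ∈ facetInterior s i := by
  have B := barycentric hd hs
  have hm : Module.finrank ℝ (Space d) = d - 1 + 1 := by
    rw [finrank_euclideanSpace_fin]; omega
  filter_upwards [B.ae_facet_pos hm hi,
    ae_restrict_mem (isCompact_cell (s.erase i)).measurableSet] with x hx hxc
  have h := (B.mem_facet_iff hi x).1 hxc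
  exact ⟨(B.mem_cell_iff x).2 h.1, h.2, hx⟩

/-! ### Integrals over the domain -/

lemma cell_ae_eq_interior (s : Finset (Space d)) :
    (interior (cell s) : Set (Space d)) =ᵐ[volume] cell s :=
  interior_ae_eq_of_null_frontier ((convex_convexHull ℝ _).addHaar_frontier volume)

/-- The two sets differ only by element boundaries, which are null as frontiers of convex sets. -/
lemma domain_ae_eq (M : ConformalMesh d D) :
    D =ᵐ[volume] ⋃ s ∈ M.elements, interior (cell s) := by
  have hnull : volume (⋃ s ∈ M.elements, frontier (cell s)) = 0 :=
    (measure_biUnion_null_iff M.elements.countable_toSet).2 fun s _ =>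
      (convex_convexHull ℝ _).addHaar_frontier volume
  have hae := measure_eq_zero_iff_ae_notMem.1 hnull
  filter_upwards [hae] with x hx
  refine propext ⟨fun hxD => ?_, fun hx' => ?_⟩
  · obtain ⟨s, hs, hxs⟩ := exists_mem_cell (M := M) (subset_closure hxD)
    refine Set.mem_biUnion (Finset.mem_coe.2 hs) ?_
    by_contra hn
    exact hx (Set.mem_biUnion (Finset.mem_coe.2 hs) ⟨subset_closure hxs, hn⟩)
  · obtain ⟨s, hs, hxs⟩ := Set.mem_iUnion₂.1 hx'
    exact interior_cell_subset hs hxs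

lemma setIntegral_domain (hd : 0 < d) (M : ConformalMesh d D) {f : Space d → ℝ}
    (hf : ∀ s ∈ M.elements, IntegrableOn f (cell s)) :
    ∫ x in D, f x = ∑ s ∈ M.elements, ∫ x in cell s, f x := by
  rw [setIntegral_congr_set M.domain_ae_eq, integral_biUnion_finset]
  · exact Finset.sum_congr rfl fun s _ => setIntegral_congr_set (cell_ae_eq_interior s)
  · exact fun s _ => isOpen_interior.measurableSet
  · intro s hs t ht hst
    rw [Function.onFun, Set.disjoint_left]
    exact fun x hxs hxt => notMem_cell_of_mem_interior hd hs ht hst hxs (_root_.interior_subset hxt)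
  · exact fun s hs => (hf s hs).mono_set _root_.interior_subset

lemma ae_cell_of_interior {s : Finset (Space d)} {P : Space d → Prop}
    (h : ∀ x ∈ interior (cell s), P x) : ∀ᵐ x ∂(volume.restrict (cell s)), P x := by
  rw [← Measure.restrict_congr_set (cell_ae_eq_interior s),
    ae_restrict_iff' isOpen_interior.measurableSet]
  exact Filter.Eventually.of_forall h

end ConformalMesh

end Mesh

/-! ### Polynomial fields -/

section Polynomials

variable {d : ℕ}

lemma hasFDerivAt_eval (P : MvPolynomial (Fin d) ℝ) (x : Space d) :
    HasFDerivAt (fun x : Space d => MvPolynomial.eval (fun j => x j) P)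
      (∑ j, MvPolynomial.eval (fun j => x j) (MvPolynomial.pderiv j P) •
        (EuclideanSpace.proj j : Space d →L[ℝ] ℝ)) x := by
  classical
  induction P using MvPolynomial.induction_on with
  | C a => simpa using hasFDerivAt_const a x
  | add p q hp hq =>
    simp only [map_add, add_smul, Finset.sum_add_distrib]
    exact hp.add hq
  | mul_X p i hp =>
    simp only [map_mul, MvPolynomial.eval_X]
    have hi : HasFDerivAt (fun x : Space d => x i) (EuclideanSpace.proj i : Space d →L[ℝ] ℝ) x :=
      (EuclideanSpace.proj i : Space d →L[ℝ] ℝ).hasFDerivAt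
    refine (hp.mul hi).congr_fderiv ?_
    ext v
    simp only [add_apply, smul_apply,
      sum_apply, PiLp.proj_apply, smul_eq_mul, Derivation.leibniz,
      MvPolynomial.pderiv_X, map_add, map_mul, MvPolynomial.eval_X, Pi.single_apply, apply_ite,
      map_zero, mul_one, mul_zero, add_mul, Finset.sum_add_distrib, ite_mul,
      zero_mul, Finset.sum_ite_eq, Finset.mem_univ, if_true, Finset.mul_sum, mul_assoc]

lemma contDiff_eval (P : MvPolynomial (Fin d) ℝ) {n : WithTop ℕ∞} :
    ContDiff ℝ n fun x : Space d => MvPolynomial.eval (fun j => x j) P := by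
  induction P using MvPolynomial.induction_on with
  | C a => simpa using contDiff_const
  | add p q hp hq => simpa using hp.add hq
  | mul_X p i hp =>
    simp only [map_mul, MvPolynomial.eval_X]
    exact hp.mul (EuclideanSpace.proj i : Space d →L[ℝ] ℝ).contDiff

lemma totalDegree_pderiv_le (P : MvPolynomial (Fin d) ℝ) (i : Fin d) :
    (MvPolynomial.pderiv i P).totalDegree ≤ P.totalDegree - 1 := by
  refine Finset.sup_le fun m hm => ?_
  rw [MvPolynomial.mem_support_iff, MvPolynomial.coeff_pderiv] at hm
  have h := MvPolynomial.le_totalDegree (MvPolynomial.mem_support_iff.2 (left_ne_zero_of_mul hm))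
  rw [Finsupp.sum_add_index' (fun _ => rfl) (fun _ _ _ => rfl),
    Finsupp.sum_single_index rfl] at h
  omega

lemma divergence_eq_sum (u : Space d → Space d) (x : Space d) :
    divergence u x = ∑ j, (fderiv ℝ u x (EuclideanSpace.single j 1)) j := by
  simp [divergence, grad, Matrix.trace]

lemma grad_congr {u v : Space d → Space d} {x : Space d} (h : fderiv ℝ u x = fderiv ℝ v x) :
    grad u x = grad v x := by
  rw [grad, grad, h]

lemma divergence_congr {u v : Space d → Space d} {x : Space d} (h : fderiv ℝ u x = fderiv ℝ v x) :
    divergence u x = divergence v x := by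
  rw [divergence, divergence, grad_congr h]

lemma continuous_grad {u : Space d → Space d} (hu : ContDiff ℝ 1 u) : Continuous (grad u) := by
  refine continuous_matrix fun i j => ?_
  have h := hu.continuous_fderiv (by norm_num)
  have h2 : Continuous fun x => fderiv ℝ u x (EuclideanSpace.single j 1) := by fun_prop
  exact (EuclideanSpace.proj i : Space d →L[ℝ] ℝ).continuous.comp h2

lemma continuous_divergence {u : Space d → Space d} (hu : ContDiff ℝ 1 u) :
    Continuous (divergence u) := (continuous_grad hu).matrix_trace

/-- Both sides are the trace of `L`, computed from the resolution of the identity and from the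
standard basis. -/
lemma Barycentric.sum_inner_apply {s : Finset (Space d)} {g : Space d → Space d} {c : Space d → ℝ}
    (B : Barycentric s g c) (L : Space d →L[ℝ] Space d) :
    ∑ i ∈ s, inner ℝ (g i) (L i) = ∑ j, (L (EuclideanSpace.single j 1)) j := by
  have h : ∀ j, L (EuclideanSpace.single j 1) = ∑ i ∈ s, (g i) j • L i := by
    intro j
    conv_lhs => rw [← B.sum_inner_smul (EuclideanSpace.single j 1), map_sum]
    refine Finset.sum_congr rfl fun i _ => ?_
    rw [map_smul, EuclideanSpace.inner_single_right]
    simp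
  simp_rw [h]
  simp only [WithLp.ofLp_sum, WithLp.ofLp_smul, Finset.sum_apply, Pi.smul_apply, smul_eq_mul]
  rw [Finset.sum_comm]
  refine Finset.sum_congr rfl fun i _ => ?_
  simp [PiLp.inner_apply, mul_comm]

variable {D : Set (Space d)} {M : ConformalMesh d D}

/-- Each restriction extends to a global `C¹` field, to which the divergence theorem applies; the
degree bound on the divergence is what makes it a pressure test function. -/
lemma IsVelocity.exists_polynomial {u : Space d → Space d} (hu : IsVelocity M u)
    {s : Finset (Space d)} (hs : s ∈ M.elements) :
    ∃ U : Space d → Space d, ContDiff ℝ 1 U ∧ (∀ x ∈ cell s, u x = U x) ∧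
      ∃ Q : MvPolynomial (Fin d) ℝ, Q.totalDegree ≤ 1 ∧
        ∀ x, divergence U x = MvPolynomial.eval (fun j => x j) Q := by
  choose P hP hPu using hu.2.2 s hs
  let U : Space d → Space d := fun x =>
    WithLp.toLp 2 fun i => MvPolynomial.eval (fun j => x j) (P i)
  have hU : ContDiff ℝ 1 U := contDiff_euclidean.2 fun i => contDiff_eval (P i)
  refine ⟨U, hU, fun x hx => ?_, ∑ i, MvPolynomial.pderiv i (P i), ?_, fun x => ?_⟩
  · ext i
    exact hPu i x hx
  · refine MvPolynomial.totalDegree_finsetSum_le fun i _ => ?_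
    have := totalDegree_pderiv_le (P i) i
    have := hP i
    omega
  · rw [divergence_eq_sum, map_sum]
    refine Finset.sum_congr rfl fun i _ => ?_
    have h1 : (fderiv ℝ U x (EuclideanSpace.single i 1)) i =
        fderiv ℝ (fun x => MvPolynomial.eval (fun j => x j) (P i)) x
          (EuclideanSpace.single i 1) := by
      have h2 := ((EuclideanSpace.proj i : Space d →L[ℝ] ℝ).hasFDerivAt.comp x
        (hU.differentiable (by norm_num) x).hasFDerivAt).fderiv
      have h3 : ((EuclideanSpace.proj i : Space d →L[ℝ] ℝ) ∘ U) =
        fun x => MvPolynomial.eval (fun j => x j) (P i) := rfl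
      rw [h3] at h2
      rw [h2]
      rfl
    rw [h1, (hasFDerivAt_eval (P i) x).fderiv]
    simp

lemma fderiv_eq_of_eqOn_cell {F : Type*} [NormedAddCommGroup F] [NormedSpace ℝ F]
    {u U : Space d → F} {s : Finset (Space d)}
    (h : ∀ x ∈ cell s, u x = U x) {x : Space d} (hx : x ∈ interior (cell s)) :
    fderiv ℝ u x = fderiv ℝ U x :=
  Filter.EventuallyEq.fderiv_eq <| by
    filter_upwards [mem_interior_iff_mem_nhds.1 hx] with y hy using h y hy

end Polynomials

/-! ### Integration by parts on a mesh -/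

section Green

open scoped Classical in
/-- The unit normal on the facet `e` of `s`, pointing into `s`. -/
noncomputable def facetNormal {d : ℕ} (s e : Finset (Space d)) : Space d :=
  ∑ i ∈ s \ e, inwardNormal s i

namespace ConformalMesh

variable {d : ℕ} {D : Set (Space d)} {M : ConformalMesh d D}

open scoped Classical in
lemma facetNormal_erase {s : Finset (Space d)} {i : Space d} (hi : i ∈ s) :
    facetNormal s (s.erase i) = inwardNormal s i := by
  rw [facetNormal, Finset.sdiff_erase_self hi, Finset.sum_singleton]

open scoped Classical in
lemma integral_divergence_cell (hd : 0 < d) {s : Finset (Space d)} (hs : s ∈ M.elements)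
    {U : Space d → Space d} (hU : ContDiff ℝ 1 U) :
    ∫ x in cell s, divergence U x = -∑ i ∈ s, ∫ x in cell (s.erase i),
      inner ℝ (facetNormal s (s.erase i)) (U x) ∂(Measure.euclideanHausdorffMeasure (d - 1)) := by
  have B := barycentric hd hs
  have hm : Module.finrank ℝ (Space d) = d - 1 + 1 := by
    rw [finrank_euclideanSpace_fin]; omega
  have h := B.divergence_theorem hm hU
  simp_rw [B.sum_inner_apply, ← divergence_eq_sum] at h
  rw [cell, ← neg_neg (∫ x in _, divergence U x), ← h]
  congr 1
  refine Finset.sum_congr rfl fun i hi => ?_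
  rw [facetNormal_erase hi]
  rfl

open scoped Classical in
lemma erase_mem_internalFaces_iff (hd : 0 < d) {s : Finset (Space d)} (hs : s ∈ M.elements)
    {i : Space d} (hi : i ∈ s) :
    s.erase i ∈ M.internalFaces ↔ ∃ t ∈ M.elements, s ≠ t ∧ s.erase i ⊆ t := by
  have hcard : (s.erase i).card = d := by
    rw [Finset.card_erase_of_mem hi, (M.mem_elements.1 hs).2]; rfl
  rw [mem_internalFaces]
  constructor
  · rintro ⟨-, -, a, ha, b, hb, hab, hea, heb⟩
    by_cases h : s = a
    · exact ⟨b, hb, h ▸ hab, heb⟩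
    · exact ⟨a, ha, h, hea⟩
  · rintro ⟨t, ht, hst, het⟩
    exact ⟨M.complex.down_closed (M.mem_elements.1 hs).1 (Finset.erase_subset i s)
      (Finset.card_pos.1 (hd.trans_eq hcard.symm)), hcard, s, hs, t, ht, hst,
      Finset.erase_subset i s, het⟩

open scoped Classical in
/-- Integration by parts against a piecewise constant weight, for a continuous, piecewise smooth
field which vanishes on the boundary. -/
theorem sum_mul_integral_divergence (hd : 0 < d) (hD : IsOpen D) {W : Space d → Space d}
    (hW0 : ∀ x ∈ frontier D, W x = 0) {U : Finset (Space d) → Space d → Space d}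
    (hU : ∀ s ∈ M.elements, ContDiff ℝ 1 (U s))
    (hWU : ∀ s ∈ M.elements, ∀ x ∈ cell s, W x = U s x) (ψ : Finset (Space d) → ℝ) :
    ∑ s ∈ M.elements, ψ s * ∫ x in cell s, divergence (U s) x =
      -∑ e ∈ M.internalFaces, ∑ s ∈ M.elements.filter (e ⊆ ·), ψ s * ∫ x in cell e,
        inner ℝ (facetNormal s e) (W x) ∂(Measure.euclideanHausdorffMeasure (d - 1)) := by
  set G : Finset (Space d) → Finset (Space d) → ℝ := fun s e => ψ s * ∫ x in cell e,
    inner ℝ (facetNormal s e) (W x) ∂(Measure.euclideanHausdorffMeasure (d - 1)) with hG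
  have h1 : ∀ s ∈ M.elements, ψ s * ∫ x in cell s, divergence (U s) x =
      -∑ e ∈ M.internalFaces.filter (· ⊆ s), G s e := by
    intro s hs
    rw [integral_divergence_cell hd hs (hU s hs), mul_neg, Finset.mul_sum]
    congr 1
    have h2 : ∀ i ∈ s, ψ s * ∫ x in cell (s.erase i), inner ℝ (facetNormal s (s.erase i)) (U s x)
        ∂(Measure.euclideanHausdorffMeasure (d - 1)) = G s (s.erase i) := by
      intro i hi
      simp only [hG]
      congr 1
      refine setIntegral_congr_fun (isCompact_cell _).measurableSet fun x hx => ?_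
      have hx' : x ∈ cell s :=
        convexHull_mono (Finset.coe_subset.2 (Finset.erase_subset i s)) hx
      simp only [hWU s hs x hx']
    rw [Finset.sum_congr rfl h2,
      ← Finset.sum_filter_add_sum_filter_not s (fun i => s.erase i ∈ M.internalFaces)]
    -- Facets that are not internal lie on the boundary up to a null set, where `W` vanishes.
    have h3 : ∑ i ∈ s with s.erase i ∉ M.internalFaces, G s (s.erase i) = 0 := by
      refine Finset.sum_eq_zero fun i hi => ?_
      obtain ⟨hi, hie⟩ := Finset.mem_filter.1 hi
      have hb : ∀ t ∈ M.elements, s.erase i ⊆ t → t = s := by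
        intro t ht het
        by_contra hne
        exact hie ((erase_mem_internalFaces_iff hd hs hi).2 ⟨t, ht, Ne.symm hne, het⟩)
      simp only [hG]
      rw [integral_eq_zero_of_ae, mul_zero]
      filter_upwards [ae_mem_facetInterior hd hs hi] with x hx
      rw [hW0 x (mem_frontier_of_boundary_facet hd hD hs hi hb hx.1 hx.2), inner_zero_right]
      rfl
    rw [h3, add_zero]
    refine Finset.sum_bij (fun i _ => s.erase i) ?_ ?_ ?_ ?_
    · intro i hi
      exact Finset.mem_filter.2 ⟨(Finset.mem_filter.1 hi).2, Finset.erase_subset i s⟩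
    · intro i hi j hj hij
      exact Finset.erase_injOn s (Finset.mem_filter.1 hi).1 (Finset.mem_filter.1 hj).1 hij
    · intro e he
      obtain ⟨he, hes⟩ := Finset.mem_filter.1 he
      obtain ⟨i, hi, rfl⟩ := exists_eq_erase hs (mem_internalFaces.1 he).2.1 hes
      exact ⟨i, Finset.mem_filter.2 ⟨hi, he⟩, rfl⟩
    · intros; rfl
  rw [Finset.sum_congr rfl h1, Finset.sum_neg_distrib]
  congr 1
  refine Finset.sum_comm' fun s e => ?_
  simp only [Finset.mem_filter]
  tauto

open scoped Classical in
/-- The contributions of the two sides of an internal face. -/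
lemma sum_adjacent (hd : 0 < d) {e : Finset (Space d)} (he : e ∈ M.internalFaces) :
    ∃ s ∈ M.elements, ∃ t ∈ M.elements, ∃ i ∈ s, ∃ k ∈ t, s ≠ t ∧ s.erase i = e ∧ t.erase k = e ∧
      inwardNormal t k = -inwardNormal s i ∧
      ∀ (ψ : Finset (Space d) → ℝ) (W : Space d → Space d),
        ∑ s ∈ M.elements.filter (e ⊆ ·), ψ s * ∫ x in cell e,
          inner ℝ (facetNormal s e) (W x) ∂(Measure.euclideanHausdorffMeasure (d - 1)) =
        (ψ s - ψ t) * ∫ x in cell e,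
          inner ℝ (inwardNormal s i) (W x) ∂(Measure.euclideanHausdorffMeasure (d - 1)) := by
  obtain ⟨s, hs, t, ht, i, hi, k, hk, hst, rfl, hke, hf⟩ := elements_filter_internalFace hd he
  have hn := inwardNormal_neighbor hd hs ht hst hi hk hke.symm
  refine ⟨s, hs, t, ht, i, hi, k, hk, hst, rfl, hke, hn, fun ψ W => ?_⟩
  have h1 : facetNormal t (s.erase i) = -inwardNormal s i := by
    rw [← hke, facetNormal_erase hk, hn]
  rw [hf, Finset.sum_pair hst, facetNormal_erase hi, h1]
  simp_rw [inner_neg_left]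
  rw [integral_neg]
  ring

/-- The divergence of a continuous, piecewise smooth field which vanishes on the boundary has
mean zero. -/
theorem sum_integral_divergence_eq_zero (hd : 0 < d) (hD : IsOpen D) {W : Space d → Space d}
    (hW0 : ∀ x ∈ frontier D, W x = 0) {U : Finset (Space d) → Space d → Space d}
    (hU : ∀ s ∈ M.elements, ContDiff ℝ 1 (U s))
    (hWU : ∀ s ∈ M.elements, ∀ x ∈ cell s, W x = U s x) :
    ∑ s ∈ M.elements, ∫ x in cell s, divergence (U s) x = 0 := by
  classical
  -- With the constant weight `1` the factor `ψ s - ψ t` vanishes on every internal face.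
  have h := sum_mul_integral_divergence hd hD hW0 hU hWU fun _ => 1
  simp only [one_mul] at h
  rw [h, neg_eq_zero]
  refine Finset.sum_eq_zero fun e he => ?_
  obtain ⟨_, -, _, -, _, -, _, -, -, -, -, -, hsum⟩ := sum_adjacent hd he
  simpa using hsum (fun _ => 1) W

end ConformalMesh

end Green

/-! ### Upwind fluxes -/

section Upwind

variable {d : ℕ}

lemma contract_smul_left (a : ℝ) (A B : Tensor d) : contract (a • A) B = a * contract A B := by
  simp [contract]

lemma contract_smul_right (a : ℝ) (A B : Tensor d) : contract A (a • B) = a * contract A B := by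
  simp [contract]

lemma contract_zero_right (A : Tensor d) : contract A 0 = 0 := by simp [contract]

namespace ConformalMesh

variable {D : Set (Space d)} {M : ConformalMesh d D}

/-- When the flow at `x` enters `s`, a short forward ray stays in the open element, where `φ` is
constant. -/
lemma downstream_eq (hd : 0 < d) {s : Finset (Space d)} (hs : s ∈ M.elements) {i x : Space d}
    (hi : i ∈ s) (hx : x ∈ facetInterior s i) {u : Space d → Space d}
    (hu : 0 < inner ℝ (inwardNormal s i) (u x)) {φ : Space d → Tensor d} {A : Tensor d}
    (hφ : ∀ y ∈ interior (cell s), φ y = A) : downstream u φ x = A := by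
  refine Filter.Tendsto.limUnder_eq (tendsto_const_nhds.congr' ?_)
  filter_upwards [eventually_mem_interior hd hs hi hx hu] with δ hδ using (hφ _ hδ).symm

lemma upstream_eq (hd : 0 < d) {s : Finset (Space d)} (hs : s ∈ M.elements) {i x : Space d}
    (hi : i ∈ s) (hx : x ∈ facetInterior s i) {u : Space d → Space d}
    (hu : inner ℝ (inwardNormal s i) (u x) < 0) {φ : Space d → Tensor d} {A : Tensor d}
    (hφ : ∀ y ∈ interior (cell s), φ y = A) : upstream u φ x = A := by
  refine Filter.Tendsto.limUnder_eq (tendsto_const_nhds.congr' ?_)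
  have hneg : Filter.Tendsto (fun δ : ℝ => -δ) (𝓝[<] 0) (𝓝[>] 0) := by
    have h := tendsto_neg_nhdsLT (a := (0 : ℝ))
    rwa [neg_zero] at h
  have hu' : 0 < inner ℝ (inwardNormal s i) (-u x) := by
    rw [inner_neg_right]; linarith
  filter_upwards [hneg.eventually (eventually_mem_interior hd hs hi hx hu')] with δ hδ
  rw [neg_smul_neg] at hδ
  exact (hφ _ hδ).symm

open scoped Classical in
/-- The upwind flux against `1 - σ⁻¹` dominates the flux of the entropy. -/
theorem entropy_flux_le (hd : 0 < d) {e : Finset (Space d)} (he : e ∈ M.internalFaces)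
    {u : Space d → Space d} (hu : ContinuousOn u (closure D)) {σ : Space d → Tensor d}
    {A : Finset (Space d) → Tensor d} (hA : ∀ s ∈ M.elements, (A s).PosDef)
    (hσ : ∀ s ∈ M.elements, ∀ x ∈ interior (cell s), σ x = A s) {κ : ℝ} (hκ : 0 ≤ κ) :
    ∑ s ∈ M.elements.filter (e ⊆ ·), κ * (A s - matLog (A s) - 1).trace * ∫ x in cell e,
        inner ℝ (facetNormal s e) (u x) ∂(Measure.euclideanHausdorffMeasure (d - 1)) ≤
      ∫ x in cell e, |inner ℝ (u x) (faceNormal e)| *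
        contract (jump u σ x) (downstream u (fun x => κ • (1 - (σ x)⁻¹)) x)
        ∂(Measure.euclideanHausdorffMeasure (d - 1)) := by
  obtain ⟨s, hs, t, ht, i, hi, k, hk, hst, rfl, hke, hn, hsum⟩ := sum_adjacent hd he
  rw [hsum]
  have hm : Module.finrank ℝ (Space d) = d - 1 + 1 := by
    rw [finrank_euclideanSpace_fin]; omega
  have B := barycentric hd hs
  set μ : Measure (Space d) := Measure.euclideanHausdorffMeasure (d - 1)
  set a : Space d → ℝ := fun x => inner ℝ (inwardNormal s i) (u x) with ha
  set C₁ := contract (A s - A t) (1 - (A s)⁻¹) with hC₁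
  set C₂ := contract (A t - A s) (1 - (A t)⁻¹) with hC₂
  have hsub : cell (s.erase i) ⊆ closure D :=
    (convexHull_mono (Finset.coe_subset.2 (Finset.erase_subset i s))).trans
      (cell_subset_closure hs)
  have hac : ContinuousOn a (cell (s.erase i)) := continuousOn_const.inner (𝕜 := ℝ) (hu.mono hsub)
  -- The flow enters `s` where `a > 0` and enters `t` where `a < 0`; `b` is the upwind integrand
  -- split by this sign.
  set b : Space d → ℝ := fun x => max (a x) 0 * (κ * C₁) + max (-a x) 0 * (κ * C₂) with hb
  have hbc : ContinuousOn b (cell (s.erase i)) :=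
    ((hac.sup continuousOn_const).mul continuousOn_const).add
      ((hac.neg.sup continuousOn_const).mul continuousOn_const)
  have hφ : ∀ r ∈ M.elements, ∀ x ∈ interior (cell r),
      κ • (1 - (σ x)⁻¹) = κ • (1 - (A r)⁻¹) := fun r hr x hx => by rw [hσ r hr x hx]
  have hae : ∀ᵐ x ∂(μ.restrict (cell (s.erase i))), |inner ℝ (u x) (faceNormal (s.erase i))| *
      contract (jump u σ x) (downstream u (fun x => κ • (1 - (σ x)⁻¹)) x) = b x := by
    have ht' := ae_mem_facetInterior hd ht hk
    rw [hke] at ht'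
    filter_upwards [ae_mem_facetInterior hd hs hi, ht'] with x hxs hxt
    have hat : inner ℝ (inwardNormal t k) (u x) = -a x := by rw [hn, inner_neg_left]
    rw [abs_inner_faceNormal hd hs hi]
    change |a x| * _ = max (a x) 0 * (κ * C₁) + max (-a x) 0 * (κ * C₂)
    rcases lt_trichotomy (a x) 0 with h | h | h
    · have hpos : 0 < inner ℝ (inwardNormal t k) (u x) := by rw [hat]; linarith
      rw [jump, downstream_eq hd ht hk hxt.2 hpos (hσ t ht), upstream_eq hd hs hi hxs.2 h (hσ s hs),
        downstream_eq hd ht hk hxt.2 hpos (hφ t ht), contract_smul_right, abs_of_neg h,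
        max_eq_right h.le, max_eq_left (by linarith)]
      ring
    -- Where the flow is tangent to the face the one-sided limits carry no information, but the
    -- factor `|a x|` is zero.
    · simp [h]
    · have hneg : inner ℝ (inwardNormal t k) (u x) < 0 := by rw [hat]; linarith
      rw [jump, downstream_eq hd hs hi hxs.2 h (hσ s hs), upstream_eq hd ht hk hxt.2 hneg (hσ t ht),
        downstream_eq hd hs hi hxs.2 h (hφ s hs), contract_smul_right, abs_of_pos h,
        max_eq_left h.le, max_eq_right (by linarith)]
      ring
  rw [integral_congr_ae hae, ← integral_const_mul]
  refine integral_mono ((B.integrableOn_facet hm hi hac).const_mul _)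
    (B.integrableOn_facet hm hi hbc) fun x => ?_
  have h1 := entropy_sub_le_contract (hA s hs) (hA t ht)
  have h2 := entropy_sub_le_contract (hA t ht) (hA s hs)
  have h3 : a x = max (a x) 0 - max (-a x) 0 := by
    rcases le_total (a x) 0 with h | h
    · rw [max_eq_right h, max_eq_left (by linarith)]; ring
    · rw [max_eq_left h, max_eq_right (by linarith)]; ring
  have h4 := mul_le_mul_of_nonneg_left h1 (mul_nonneg hκ (le_max_right (a x) 0))
  have h5 := mul_le_mul_of_nonneg_left h2 (mul_nonneg hκ (le_max_right (-a x) 0))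
  change (κ * _ - κ * _) * a x ≤ max (a x) 0 * (κ * C₁) + max (-a x) 0 * (κ * C₂)
  generalize max (a x) 0 = r at *
  generalize max (-a x) 0 = r' at *
  rw [h3]
  linarith

end ConformalMesh

end Upwind

/-! ### Piecewise continuous functions -/

section Piecewise

variable {d : ℕ} {D : Set (Space d)} {M : ConformalMesh d D}

/-- On every open element, `f` agrees with a continuous function. -/
def PiecewiseContinuous (M : ConformalMesh d D) {F : Type*} [TopologicalSpace F]
    (f : Space d → F) : Prop :=
  ∀ s ∈ M.elements, ∃ g : Space d → F, Continuous g ∧ ∀ x ∈ interior (cell s), f x = g x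

namespace PiecewiseContinuous

variable {F G H : Type*} [TopologicalSpace F] [TopologicalSpace G] [TopologicalSpace H]

lemma map {f : Space d → F} (hf : PiecewiseContinuous M f) {h : F → G} (hh : Continuous h) :
    PiecewiseContinuous M fun x => h (f x) := fun s hs => by
  obtain ⟨f', hf', hff⟩ := hf s hs
  exact ⟨fun x => h (f' x), hh.comp hf', fun x hx => congrArg h (hff x hx)⟩

lemma map₂ {f : Space d → F} {g : Space d → G} (hf : PiecewiseContinuous M f)
    (hg : PiecewiseContinuous M g) {h : F → G → H} (hh : Continuous fun q : F × G => h q.1 q.2) :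
    PiecewiseContinuous M fun x => h (f x) (g x) := fun s hs => by
  obtain ⟨f', hf', hff⟩ := hf s hs
  obtain ⟨g', hg', hgg⟩ := hg s hs
  exact ⟨fun x => h (f' x) (g' x), hh.comp (hf'.prodMk hg'), fun x hx =>
    congrArg₂ h (hff x hx) (hgg x hx)⟩

lemma add [Add F] [ContinuousAdd F] {f g : Space d → F} (hf : PiecewiseContinuous M f)
    (hg : PiecewiseContinuous M g) : PiecewiseContinuous M fun x => f x + g x :=
  hf.map₂ hg continuous_add

lemma sub [Sub F] [ContinuousSub F] {f g : Space d → F} (hf : PiecewiseContinuous M f)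
    (hg : PiecewiseContinuous M g) : PiecewiseContinuous M fun x => f x - g x :=
  hf.map₂ hg continuous_sub

lemma mul [Mul F] [ContinuousMul F] {f g : Space d → F} (hf : PiecewiseContinuous M f)
    (hg : PiecewiseContinuous M g) : PiecewiseContinuous M fun x => f x * g x :=
  hf.map₂ hg continuous_mul

lemma const_mul {f : Space d → ℝ} (hf : PiecewiseContinuous M f) (a : ℝ) :
    PiecewiseContinuous M fun x => a * f x :=
  hf.map (continuous_const_mul a)

lemma contract {f g : Space d → Tensor d} (hf : PiecewiseContinuous M f)
    (hg : PiecewiseContinuous M g) : PiecewiseContinuous M fun x => contract (f x) (g x) :=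
  hf.map₂ hg (by unfold OldroydDG.contract; fun_prop)

lemma integrableOn_cell {f : Space d → ℝ} (hf : PiecewiseContinuous M f)
    {s : Finset (Space d)} (hs : s ∈ M.elements) : IntegrableOn f (cell s) := by
  obtain ⟨g, hg, hfg⟩ := hf s hs
  refine (hg.continuousOn.integrableOn_compact (ConformalMesh.isCompact_cell s)).congr ?_
  exact ConformalMesh.ae_cell_of_interior fun x hx => (hfg x hx).symm

lemma integrableOn {f : Space d → ℝ} (hf : PiecewiseContinuous M f) : IntegrableOn f D := by
  have h := (integrableOn_finset_iUnion (s := M.elements) (t := fun s => interior (cell s))).2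
    fun s hs => (hf.integrableOn_cell hs).mono_set interior_subset
  exact h.congr_set_ae M.domain_ae_eq

lemma setIntegral (hd : 0 < d) {f : Space d → ℝ} (hf : PiecewiseContinuous M f) :
    ∫ x in D, f x = ∑ s ∈ M.elements, ∫ x in cell s, f x :=
  ConformalMesh.setIntegral_domain hd M fun _ hs => hf.integrableOn_cell hs

end PiecewiseContinuous

lemma ConformalMesh.ae_domain (M : ConformalMesh d D) {P : Space d → Prop}
    (h : ∀ s ∈ M.elements, ∀ x ∈ interior (cell s), P x) :
    ∀ᵐ x ∂(volume.restrict D), P x := by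
  rw [Measure.restrict_congr_set M.domain_ae_eq, ae_restrict_biUnion_finset_iff]
  intro s hs
  rw [ae_restrict_iff' isOpen_interior.measurableSet]
  exact Filter.Eventually.of_forall (h s hs)

lemma IsVelocity.piecewiseContinuous {u : Space d → Space d} (hu : IsVelocity M u) :
    PiecewiseContinuous M u := fun s hs => by
  obtain ⟨U, hU, huU, -⟩ := hu.exists_polynomial hs
  exact ⟨U, hU.continuous, fun x hx => huU x (interior_subset hx)⟩

lemma IsVelocity.piecewiseContinuous_fderiv {u : Space d → Space d} (hu : IsVelocity M u) :
    PiecewiseContinuous M (fderiv ℝ u) := fun s hs => by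
  obtain ⟨U, hU, huU, -⟩ := hu.exists_polynomial hs
  exact ⟨fderiv ℝ U, hU.continuous_fderiv (by norm_num), fun x hx => fderiv_eq_of_eqOn_cell huU hx⟩

lemma IsVelocity.piecewiseContinuous_grad {u : Space d → Space d} (hu : IsVelocity M u) :
    PiecewiseContinuous M (grad u) := fun s hs => by
  obtain ⟨U, hU, huU, -⟩ := hu.exists_polynomial hs
  exact ⟨grad U, continuous_grad hU, fun x hx => grad_congr (fderiv_eq_of_eqOn_cell huU hx)⟩

lemma IsVelocity.piecewiseContinuous_divergence {u : Space d → Space d} (hu : IsVelocity M u) :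
    PiecewiseContinuous M (divergence u) := fun s hs => by
  obtain ⟨U, hU, huU, -⟩ := hu.exists_polynomial hs
  exact ⟨divergence U, continuous_divergence hU,
    fun x hx => divergence_congr (fderiv_eq_of_eqOn_cell huU hx)⟩

lemma IsPressure.piecewiseContinuous {p : Space d → ℝ} (hp : IsPressure M p) :
    PiecewiseContinuous M p := fun s hs => by
  obtain ⟨P, -, hP⟩ := hp s hs
  exact ⟨_, (contDiff_eval P (n := 0)).continuous, hP⟩

/-- No continuity of `h` is required, since the stress takes one value per element. Hence `matLog`
and the inverse cause no difficulty. -/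
lemma IsStress.piecewiseContinuous {σ : Space d → Tensor d} (hσ : IsStress M σ) {F : Type*}
    [TopologicalSpace F] (h : Tensor d → F) : PiecewiseContinuous M fun x => h (σ x) :=
  fun s hs => by
    obtain ⟨A, -, hA⟩ := hσ s hs
    exact ⟨fun _ => h A, continuous_const, fun x hx => congrArg h (hA x hx)⟩

lemma IsVelocity.isPressure_divergence {u : Space d → Space d} (hu : IsVelocity M u) :
    IsPressure M (divergence u) := fun s hs => by
  obtain ⟨U, -, huU, Q, hQ, hUQ⟩ := hu.exists_polynomial hs
  refine ⟨Q, hQ, fun x hx => ?_⟩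
  rw [divergence_congr (fderiv_eq_of_eqOn_cell huU hx), hUQ]

/-- The velocity is pointwise divergence free as soon as its divergence is orthogonal to itself. -/
lemma IsVelocity.divergence_eq_zero (hd : 0 < d) {u : Space d → Space d} (hu : IsVelocity M u)
    (h : ∫ x in D, divergence u x * divergence u x = 0) :
    ∀ s ∈ M.elements, ∀ x ∈ interior (cell s), divergence u x = 0 := by
  intro s hs
  have hpc := hu.piecewiseContinuous_divergence.mul hu.piecewiseContinuous_divergence
  rw [hpc.setIntegral hd, Finset.sum_eq_zero_iff_of_nonneg fun s _ =>
    integral_nonneg fun x => mul_self_nonneg _] at h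
  have h1 := (integral_eq_zero_iff_of_nonneg (fun x => mul_self_nonneg _)
    (hpc.integrableOn_cell hs)).1 (h s hs)
  rw [← Measure.restrict_congr_set (ConformalMesh.cell_ae_eq_interior s)] at h1
  have h2 : divergence u =ᵐ[volume.restrict (interior (cell s))] fun _ => 0 := by
    filter_upwards [h1] with x hx using mul_self_eq_zero.1 hx
  obtain ⟨g, hg, hug⟩ := hu.piecewiseContinuous_divergence s hs
  -- Continuity on the open element upgrades vanishing almost everywhere to vanishing everywhere.
  exact Measure.eqOn_open_of_ae_eq h2 isOpen_interior (hg.continuousOn.congr hug)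
    continuousOn_const

end Piecewise

/-! ### The energy balance of a time step -/

section Energy

variable {d : ℕ} {D : Set (Space d)} {M : ConformalMesh d D}

/-- For divergence free `w` this exhibits convection as half the divergence of a field that vanishes
wherever `w` does. -/
lemma divergence_normSq_smul {u w : Space d → Space d} (hu : ContDiff ℝ 1 u) (hw : ContDiff ℝ 1 w)
    (x : Space d) : divergence (fun x => ‖u x‖ ^ 2 • w x) x =
      ‖u x‖ ^ 2 * divergence w x + 2 * inner ℝ (fderiv ℝ u x (w x)) (u x) := by
  have hu' := (hu.differentiable (by norm_num) x).hasFDerivAt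
  have hw' := (hw.differentiable (by norm_num) x).hasFDerivAt
  have h : fderiv ℝ (fun x => ‖u x‖ ^ 2 • w x) x = _ := (hu'.norm_sq.smul hw').fderiv
  have hexp : w x = ∑ j, (w x) j • EuclideanSpace.single j (1 : ℝ) := by
    ext k
    simp [Pi.single_apply]
  have hlin : inner ℝ (fderiv ℝ u x (w x)) (u x) =
      ∑ j, (w x) j * inner ℝ (u x) (fderiv ℝ u x (EuclideanSpace.single j 1)) := by
    conv_lhs => rw [hexp, map_sum, real_inner_comm, inner_sum]
    simp_rw [map_smul, inner_smul_right]
  rw [divergence_eq_sum, divergence_eq_sum, hlin, Finset.mul_sum, Finset.mul_sum,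
    ← Finset.sum_add_distrib]
  refine Finset.sum_congr rfl fun j _ => ?_
  rw [h]
  simp
  ring

/-- The convection term is skew-symmetric for a divergence free transport velocity. -/
lemma integral_convection_eq_zero (hd : 0 < d) (hD : IsOpen D) {u w : Space d → Space d}
    (hu : IsVelocity M u) (hw : IsVelocity M w)
    (hdiv : ∀ s ∈ M.elements, ∀ x ∈ interior (cell s), divergence w x = 0) :
    ∫ x in D, inner ℝ (fderiv ℝ u x (w x)) (u x) = 0 := by
  classical
  have hpc : PiecewiseContinuous M fun x => inner ℝ (fderiv ℝ u x (w x)) (u x) :=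
    (hu.piecewiseContinuous_fderiv.map₂ hw.piecewiseContinuous
      (h := fun L v => L v) (by fun_prop)).map₂ hu.piecewiseContinuous continuous_inner
  rw [hpc.setIntegral hd]
  choose! U hU huU _ using fun s (hs : s ∈ M.elements) => hu.exists_polynomial hs
  choose! W hW hwW _ using fun s (hs : s ∈ M.elements) => hw.exists_polynomial hs
  have h := ConformalMesh.sum_integral_divergence_eq_zero (M := M) hd hD
    (W := fun x => ‖u x‖ ^ 2 • w x) (U := fun s x => ‖U s x‖ ^ 2 • W s x)
    (fun x hx => by simp [hw.2.1 x hx])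
    (fun s hs => ((hU s hs).norm_sq ℝ).smul (hW s hs))
    (fun s hs x hx => by simp only [huU s hs x hx, hwW s hs x hx])
  have h2 : ∀ s ∈ M.elements, ∫ x in cell s, divergence (fun x => ‖U s x‖ ^ 2 • W s x) x =
      2 * ∫ x in cell s, inner ℝ (fderiv ℝ u x (w x)) (u x) := by
    intro s hs
    rw [← integral_const_mul]
    refine integral_congr_ae (ConformalMesh.ae_cell_of_interior fun x hx => ?_)
    have hx' := _root_.interior_subset hx
    beta_reduce
    rw [divergence_normSq_smul (hU s hs) (hW s hs),
      ← divergence_congr (fderiv_eq_of_eqOn_cell (hwW s hs) hx), hdiv s hs x hx,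
      fderiv_eq_of_eqOn_cell (huU s hs) hx, huU s hs x hx', hwW s hs x hx', mul_zero, zero_add]
  rw [Finset.sum_congr rfl h2, ← Finset.mul_sum] at h
  linarith

/-- The volume density of the variational formulation. -/
noncomputable def volumeDensity (Re Wi ε Δt : ℝ)
    (u₀ : Space d → Space d) (σ₀ : Space d → Tensor d)
    (u₁ : Space d → Space d) (p₁ : Space d → ℝ) (σ₁ : Space d → Tensor d)
    (v : Space d → Space d) (q : Space d → ℝ) (φ : Space d → Tensor d) (x : Space d) : ℝ :=
  Re * inner ℝ (Δt⁻¹ • (u₁ x - u₀ x) + fderiv ℝ u₁ x (u₀ x)) (v x)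
      - p₁ x * divergence v x + q x * divergence u₁ x
      + (1 - ε) * contract (grad u₁ x) (grad v x)
      + ε / Wi * contract (σ₁ x) (grad v x)
      + contract (Δt⁻¹ • (σ₁ x - σ₀ x)) (φ x)
      - contract (grad u₁ x * σ₁ x + σ₁ x * (grad u₁ x).transpose) (φ x)
      + 1 / Wi * contract (σ₁ x - 1) (φ x)

/-- The discrete velocities are pointwise divergence free. -/
lemma divergence_eq_zero_of_step (hd : 0 < d) {Re Wi ε Δt : ℝ}
    {u₀ : Space d → Space d} {σ₀ : Space d → Tensor d}
    {u₁ : Space d → Space d} {p₁ : Space d → ℝ} {σ₁ : Space d → Tensor d} (hu₁ : IsVelocity M u₁)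
    (hstep : ∀ (v : Space d → Space d) (q : Space d → ℝ) (φ : Space d → Tensor d),
      IsVelocity M v → IsPressure M q → IsStress M φ →
        0 = dgForm M Re Wi ε Δt u₀ σ₀ u₁ p₁ σ₁ v q φ) :
    ∀ s ∈ M.elements, ∀ x ∈ interior (cell s), divergence u₁ x = 0 := by
  refine hu₁.divergence_eq_zero hd ?_
  have hv : IsVelocity M (fun _ => (0 : Space d)) :=
    ⟨continuousOn_const, fun _ _ => rfl, fun _ _ _ => ⟨0, by simp, fun _ _ => by simp⟩⟩
  have hφ : IsStress M (fun _ => (0 : Tensor d)) := fun _ _ =>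
    ⟨0, Matrix.isSymm_zero, fun _ _ => rfl⟩
  -- With `v = 0`, `φ = 0` and `q = div u₁`, only `∫ (div u₁)²` survives.
  have h := hstep _ _ _ hv hu₁.isPressure_divergence hφ
  have hg : ∀ x, grad (fun _ : Space d => (0 : Space d)) x = 0 := by
    intro x
    ext i j
    simp [grad]
  have hdown : ∀ x, downstream u₀ (fun _ => (0 : Tensor d)) x = 0 := fun x =>
    Filter.Tendsto.limUnder_eq tendsto_const_nhds
  have hpc := hu₁.piecewiseContinuous_divergence.mul hu₁.piecewiseContinuous_divergence
  rw [dgForm] at h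
  simp only [hg, hdown, contract_zero_right, inner_zero_right, divergence, Matrix.trace_zero,
    mul_zero, integral_zero, Finset.sum_const_zero, add_zero, sub_zero, zero_add] at h
  rw [hpc.setIntegral hd]
  exact h.symm

lemma contract_self_nonneg (A : Tensor d) : 0 ≤ contract A A := by
  rw [contract, Matrix.trace]
  refine Finset.sum_nonneg fun i _ => ?_
  rw [Matrix.diag_apply, Matrix.mul_apply]
  exact Finset.sum_nonneg fun j _ => mul_self_nonneg _

lemma norm_sub_sq_identity (v w : Space d) :
    inner ℝ (v - w) v = (‖v‖ ^ 2 - ‖w‖ ^ 2 + ‖v - w‖ ^ 2) / 2 := by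
  rw [norm_sub_sq_real, inner_sub_left, real_inner_self_eq_norm_sq, real_inner_comm]
  ring

/-- The local energy estimate behind the choice of test functions. -/
lemma le_volumeDensity {Re Wi ε Δt : ℝ} (hWi : 0 < Wi) (hε : 0 ≤ ε) (hΔt : 0 < Δt)
    {u₀ : Space d → Space d} {σ₀ : Space d → Tensor d}
    {u₁ : Space d → Space d} {p₁ : Space d → ℝ} {σ₁ : Space d → Tensor d} {x : Space d}
    (hσ₀ : (σ₀ x).PosDef) (hσ₁ : (σ₁ x).PosDef) (hdiv : divergence u₁ x = 0) :
    Δt⁻¹ * (Re / 2 * ‖u₁ x‖ ^ 2 - Re / 2 * ‖u₀ x‖ ^ 2 + Re / 2 * ‖u₁ x - u₀ x‖ ^ 2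
        + (ε / (2 * Wi) * (σ₁ x - matLog (σ₁ x) - 1).trace
          - ε / (2 * Wi) * (σ₀ x - matLog (σ₀ x) - 1).trace))
      + ((1 - ε) * contract (grad u₁ x) (grad u₁ x)
        + ε / (2 * Wi ^ 2) * (σ₁ x + (σ₁ x)⁻¹ - (2 : ℝ) • 1).trace)
      + Re * inner ℝ (fderiv ℝ u₁ x (u₀ x)) (u₁ x) ≤
    volumeDensity Re Wi ε Δt u₀ σ₀ u₁ p₁ σ₁ u₁ p₁
      (fun x => (ε / (2 * Wi)) • (1 - (σ₁ x)⁻¹)) x := by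
  have hκ : 0 ≤ ε / (2 * Wi) := by positivity
  have hdiv' : (grad u₁ x).trace = 0 := hdiv
  have h1 := mul_le_mul_of_nonneg_left (entropy_sub_le_contract hσ₁ hσ₀)
    (mul_nonneg (inv_nonneg.2 hΔt.le) hκ)
  simp only [volumeDensity]
  rw [hdiv, contract_smul_right, contract_smul_right, contract_smul_right, contract_smul_left,
    contract_upper_convected hσ₁, contract_sub_one_one_sub_inv hσ₁, hdiv', inner_add_left,
    real_inner_smul_left, norm_sub_sq_identity]
  have h2 : 1 / Wi * (ε / (2 * Wi) * (σ₁ x + (σ₁ x)⁻¹ - (2 : ℝ) • 1).trace) =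
      ε / (2 * Wi ^ 2) * (σ₁ x + (σ₁ x)⁻¹ - (2 : ℝ) • 1).trace := by
    field_simp
  -- This cancellation fixes the weight `ε / (2 * Wi)` in the test function: the upper-convected
  -- term carries a factor `2`.
  have h3 : ε / (2 * Wi) * (2 * contract (σ₁ x) (grad u₁ x) - 2 * 0) =
      ε / Wi * contract (σ₁ x) (grad u₁ x) := by
    field_simp
    ring
  rw [h2, h3]
  linarith

/-- The free energy estimate for one time step. -/
theorem energy_step (hd : 0 < d) (hD : IsOpen D) {Re Wi ε Δt : ℝ} (hWi : 0 < Wi)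
    (hε : 0 ≤ ε) (hΔt : 0 < Δt) {u₀ : Space d → Space d} {σ₀ : Space d → Tensor d}
    {u₁ : Space d → Space d} {p₁ : Space d → ℝ} {σ₁ : Space d → Tensor d}
    (hu₀ : IsVelocity M u₀) (hσ₀ : IsStress M σ₀) (hu₁ : IsVelocity M u₁) (hp₁ : IsPressure M p₁)
    (hσ₁ : IsStress M σ₁) (hpos₀ : IsPosDefStress M σ₀) (hpos₁ : IsPosDefStress M σ₁)
    (hdiv₀ : ∀ s ∈ M.elements, ∀ x ∈ interior (cell s), divergence u₀ x = 0)
    (hstep : ∀ (v : Space d → Space d) (q : Space d → ℝ) (φ : Space d → Tensor d),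
      IsVelocity M v → IsPressure M q → IsStress M φ →
        0 = dgForm M Re Wi ε Δt u₀ σ₀ u₁ p₁ σ₁ v q φ) :
    freeEnergy D Re Wi ε u₁ σ₁ - freeEnergy D Re Wi ε u₀ σ₀
      + (∫ x in D, Re / 2 * ‖u₁ x - u₀ x‖ ^ 2)
      + Δt * (∫ x in D, ((1 - ε) * contract (grad u₁ x) (grad u₁ x)
          + ε / (2 * Wi ^ 2) * (σ₁ x + (σ₁ x)⁻¹ - (2 : ℝ) • 1).trace)) ≤ 0 := by
  classical
  have hκ : 0 ≤ ε / (2 * Wi) := by positivity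
  have hdiv₁ := divergence_eq_zero_of_step hd hu₁ hstep
  set φ : Space d → Tensor d := fun x => (ε / (2 * Wi)) • (1 - (σ₁ x)⁻¹) with hφ
  have hφs : IsStress M φ := by
    intro s hs
    obtain ⟨A, hA, hσA⟩ := hσ₁ s hs
    refine ⟨(ε / (2 * Wi)) • (1 - A⁻¹), ?_, fun x hx => by simp only [hφ, hσA x hx]⟩
    exact (Matrix.isSymm_one.sub hA.inv).smul _
  -- the face terms
  have hface : 0 ≤ ∑ e ∈ M.internalFaces, ∫ x in cell e, |inner ℝ (u₀ x) (faceNormal e)|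
      * contract (jump u₀ σ₁ x) (downstream u₀ φ x)
        ∂(Measure.euclideanHausdorffMeasure (d - 1)) := by
    choose! A _ hσA using hσ₁
    choose! U hU huU _ using fun s (hs : s ∈ M.elements) => hu₀.exists_polynomial hs
    -- The barycenter shows that the open element is nonempty, so that positivity of the field
    -- passes to its constant value.
    have hApos : ∀ s ∈ M.elements, (A s).PosDef := by
      intro s hs
      have B := M.barycentric hd hs
      have hx : ∑ y ∈ s, (s.card : ℝ)⁻¹ • y ∈ interior (cell s) :=
        (B.mem_interior_iff _).2 fun j hj => B.coord_barycenter_pos subset_rfl hj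
      rw [← hσA s hs _ hx]
      exact hpos₁ s hs _ hx
    -- Green's formula for `u₀`, weighted by the entropy of `σ₁` on each element: every element
    -- integral is zero, so the entropy fluxes sum to zero over the internal faces.
    have h1 := ConformalMesh.sum_mul_integral_divergence (M := M) hd hD hu₀.2.1 hU huU
      fun s => ε / (2 * Wi) * (A s - matLog (A s) - 1).trace
    have h2 : ∀ s ∈ M.elements, ∫ x in cell s, divergence (U s) x = 0 := by
      intro s hs
      refine integral_eq_zero_of_ae (ConformalMesh.ae_cell_of_interior fun x hx => ?_)
      rw [← divergence_congr (fderiv_eq_of_eqOn_cell (huU s hs) hx)]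
      exact hdiv₀ s hs x hx
    rw [Finset.sum_eq_zero fun s hs => by rw [h2 s hs, mul_zero], eq_comm, neg_eq_zero] at h1
    rw [← h1]
    exact Finset.sum_le_sum fun e he =>
      ConformalMesh.entropy_flux_le hd he hu₀.1 hApos hσA hκ
  -- piecewise continuity of the densities
  have pu₀ := hu₀.piecewiseContinuous
  have pu₁ := hu₁.piecewiseContinuous
  have pg₁ := hu₁.piecewiseContinuous_grad
  have pdiv := hu₁.piecewiseContinuous_divergence
  have pp := hp₁.piecewiseContinuous
  have pφ := hφs.piecewiseContinuous id
  have pσ₀ := hσ₀.piecewiseContinuous id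
  have pσ₁ := hσ₁.piecewiseContinuous id
  have pconv₀ : PiecewiseContinuous M fun x => fderiv ℝ u₁ x (u₀ x) :=
    hu₁.piecewiseContinuous_fderiv.map₂ pu₀ (h := fun L v => L v) (by fun_prop)
  have pconv : PiecewiseContinuous M fun x => inner ℝ (fderiv ℝ u₁ x (u₀ x)) (u₁ x) :=
    pconv₀.map₂ pu₁ continuous_inner
  have pI : PiecewiseContinuous M (volumeDensity Re Wi ε Δt u₀ σ₀ u₁ p₁ σ₁ u₁ p₁ φ) := by
    refine ((((((PiecewiseContinuous.sub ?_ (pp.mul pdiv)).add (pp.mul pdiv)).add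
      ((pg₁.contract pg₁).const_mul _)).add ((pσ₁.contract pg₁).const_mul _)).add
      (PiecewiseContinuous.contract ?_ pφ)).sub (PiecewiseContinuous.contract ?_ pφ)).add
      ((PiecewiseContinuous.contract ?_ pφ).const_mul _)
    · exact ((((pu₁.sub pu₀).map (continuous_const_smul Δt⁻¹)).add pconv₀).map₂ pu₁
        continuous_inner).const_mul Re
    · exact (pσ₁.sub pσ₀).map (continuous_const_smul Δt⁻¹)
    · exact (pg₁.mul pσ₁).add (pσ₁.mul (pg₁.map (h := Matrix.transpose) (by fun_prop)))
    · exact hσ₁.piecewiseContinuous fun A => A - 1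
  have pn₁ : PiecewiseContinuous M fun x => Re / 2 * ‖u₁ x‖ ^ 2 :=
    pu₁.map (h := fun v => Re / 2 * ‖v‖ ^ 2) (by fun_prop)
  have pn₀ : PiecewiseContinuous M fun x => Re / 2 * ‖u₀ x‖ ^ 2 :=
    pu₀.map (h := fun v => Re / 2 * ‖v‖ ^ 2) (by fun_prop)
  have pn : PiecewiseContinuous M fun x => Re / 2 * ‖u₁ x - u₀ x‖ ^ 2 :=
    (pu₁.sub pu₀).map (h := fun v => Re / 2 * ‖v‖ ^ 2) (by fun_prop)
  have pe₁ : PiecewiseContinuous M fun x => ε / (2 * Wi) * (σ₁ x - matLog (σ₁ x) - 1).trace :=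
    hσ₁.piecewiseContinuous fun A => ε / (2 * Wi) * (A - matLog A - 1).trace
  have pe₀ : PiecewiseContinuous M fun x => ε / (2 * Wi) * (σ₀ x - matLog (σ₀ x) - 1).trace :=
    hσ₀.piecewiseContinuous fun A => ε / (2 * Wi) * (A - matLog A - 1).trace
  have pR : PiecewiseContinuous M fun x => (1 - ε) * contract (grad u₁ x) (grad u₁ x)
      + ε / (2 * Wi ^ 2) * (σ₁ x + (σ₁ x)⁻¹ - (2 : ℝ) • 1).trace :=
    ((pg₁.contract pg₁).const_mul _).add (hσ₁.piecewiseContinuous fun A =>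
      ε / (2 * Wi ^ 2) * (A + A⁻¹ - (2 : ℝ) • 1).trace)
  -- the volume terms
  have hvol : ∫ x in D, volumeDensity Re Wi ε Δt u₀ σ₀ u₁ p₁ σ₁ u₁ p₁ φ x ≤ 0 := by
    -- Volume and face parts sum to zero and the face part is nonnegative.
    have h := hstep u₁ p₁ φ hu₁ hp₁ hφs
    rw [dgForm] at h
    rw [pI.setIntegral hd]
    simp only [volumeDensity]
    linarith
  have pT := ((pn₁.sub pn₀).add pn).add (pe₁.sub pe₀)
  have hle := setIntegral_mono_ae_restrict
    (((pT.const_mul Δt⁻¹).add pR).add (pconv.const_mul Re)).integrableOn pI.integrableOn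
    (M.ae_domain fun s hs x hx =>
      le_volumeDensity (p₁ := p₁) hWi hε hΔt (hpos₀ s hs x hx) (hpos₁ s hs x hx) (hdiv₁ s hs x hx))
  rw [integral_add ((pT.const_mul Δt⁻¹).add pR).integrableOn (pconv.const_mul Re).integrableOn,
    integral_add (pT.const_mul Δt⁻¹).integrableOn pR.integrableOn, integral_const_mul,
    integral_const_mul Re, integral_convection_eq_zero hd hD hu₁ hu₀ hdiv₀,
    integral_add ((pn₁.sub pn₀).add pn).integrableOn (pe₁.sub pe₀).integrableOn,
    integral_add (pn₁.sub pn₀).integrableOn pn.integrableOn,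
    integral_sub pn₁.integrableOn pn₀.integrableOn,
    integral_sub pe₁.integrableOn pe₀.integrableOn, mul_zero, add_zero] at hle
  have hfinal := mul_le_mul_of_nonneg_left (hle.trans hvol) hΔt.le
  rw [mul_zero, mul_add, ← mul_assoc, mul_inv_cancel₀ hΔt.ne', one_mul] at hfinal
  simp only [freeEnergy, ← integral_const_mul] at hfinal ⊢
  linarith

end Energy

end OldroydDG

/-! ### Decay of the free energy along the scheme -/

theorem mainTheorem2 (d : ℕ) (hd : d = 2 ∨ d = 3)
    (D : Set (OldroydDG.Space d)) (hD : IsOpen D) (M : OldroydDG.ConformalMesh d D)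
    (Re Wi ε : ℝ) (hRe : 0 ≤ Re) (hWi : 0 < Wi) (hε₀ : 0 ≤ ε) (hε₁ : ε < 1)
    (T : ℝ) (hT : 0 < T) (N : ℕ) (hN : 0 < N)
    (u : ℕ → OldroydDG.Space d → OldroydDG.Space d)
    (p : ℕ → OldroydDG.Space d → ℝ)
    (σ : ℕ → OldroydDG.Space d → OldroydDG.Tensor d)
    (hsol : OldroydDG.IsDGSolution M Re Wi ε (T / N) N u p σ)
    (hdiv : OldroydDG.IsDiscretelyDivFree M (u 0))
    (hpos : ∀ n ≤ N, OldroydDG.IsPosDefStress M (σ n)) :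
    (∀ n < N,
      OldroydDG.freeEnergy D Re Wi ε (u (n + 1)) (σ (n + 1))
          - OldroydDG.freeEnergy D Re Wi ε (u n) (σ n)
        + (∫ x in D, Re / 2 * ‖u (n + 1) x - u n x‖ ^ 2)
        + T / N * (∫ x in D,
            ((1 - ε) * OldroydDG.contract (OldroydDG.grad (u (n + 1)) x)
                (OldroydDG.grad (u (n + 1)) x)
              + ε / (2 * Wi ^ 2)
                * (σ (n + 1) x + (σ (n + 1) x)⁻¹ - (2 : ℝ) • 1).trace)) ≤ 0) ∧
    (∀ m n, m ≤ n → n ≤ N →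
      OldroydDG.freeEnergy D Re Wi ε (u n) (σ n) ≤ OldroydDG.freeEnergy D Re Wi ε (u m) (σ m)) := by
  have hd0 : 0 < d := by omega
  have hΔt : 0 < T / N := div_pos hT (by exact_mod_cast hN)
  have hdivs : ∀ n ≤ N, ∀ s ∈ M.elements, ∀ x ∈ interior (OldroydDG.cell s),
      OldroydDG.divergence (u n) x = 0 := by
    intro n hn
    -- The initial velocity is covered by the hypothesis; each later one is divergence free by the
    -- step that produced it.
    cases n with
    | zero =>
      have hu := hsol.velocity 0 hn
      exact hu.divergence_eq_zero hd0 (hdiv _ hu.isPressure_divergence)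
    | succ n => exact OldroydDG.divergence_eq_zero_of_step hd0 (hsol.velocity _ hn) (hsol.step n hn)
  have hmain := fun n (hn : n < N) => OldroydDG.energy_step hd0 hD hWi hε₀ hΔt
    (hsol.velocity n hn.le) (hsol.stress n hn.le) (hsol.velocity (n + 1) hn)
    (hsol.pressure (n + 1) hn) (hsol.stress (n + 1) hn) (hpos n hn.le) (hpos (n + 1) hn)
    (hdivs n hn.le) (hsol.step n hn)
  refine ⟨hmain, fun m n hmn hn => ?_⟩
  induction n, hmn using Nat.le_induction with
  | base => exact le_rfl
  | succ n _ ih =>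
    refine le_trans ?_ (ih (by omega))
    have h := hmain n hn
    have h1 : 0 ≤ ∫ x in D, Re / 2 * ‖u (n + 1) x - u n x‖ ^ 2 :=
      integral_nonneg fun x => by positivity
    have h2 : 0 ≤ ∫ x in D, ((1 - ε) * OldroydDG.contract (OldroydDG.grad (u (n + 1)) x)
        (OldroydDG.grad (u (n + 1)) x)
        + ε / (2 * Wi ^ 2) * (σ (n + 1) x + (σ (n + 1) x)⁻¹ - (2 : ℝ) • 1).trace) := by
      refine integral_nonneg_of_ae (M.ae_domain fun s hs x hx => ?_)
      have h3 := OldroydDG.trace_add_inv_sub_two_nonneg (hpos (n + 1) hn s hs x hx)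
      have h4 := OldroydDG.contract_self_nonneg (OldroydDG.grad (u (n + 1)) x)
      have h5 : 0 ≤ 1 - ε := by linarith
      have h6 : 0 ≤ ε / (2 * Wi ^ 2) := by positivity
      exact add_nonneg (mul_nonneg h5 h4) (mul_nonneg h6 h3)
    have h7 := mul_nonneg hΔt.le h2
    linarith
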